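/- All graphs are finite and simple. For $k\ge 1$, the book graph $B_k$ consists of $k$ triangles sharing a common edge. A graph is $H$-free if it does not contain $H$ as a (not necessarily induced) subgraph, and the spectral radius $\rho(G)$ of a graph $G$ is the largest eigenvalue of its adjacency matrix. Let $\mathrm{Ex}_3(n,H)$ be the set of non-bipartite $H$-free graphs on $n$ vertices that have the maximum number of edges among all non-bipartite $H$-free graphs on $n$ vertices, and let $\mathrm{Spex}_3(n,H)$ be the set of non-bipartite $H$-free graphs on $n$ vertices that have the maximum spectral radius among all non-bipartite $H$-free graphs on $n$ vertices. Corollary. For every integer $r\ge 1$ there exists $n_0=n_0(r)$ such that for all $n\ge n_0$, $$\mathrm{Spex}_3(n,B_{r+1})\subseteq \mathrm{Ex}_3(n,B_{r+1}).$$ -/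

import Mathlib

/-- The book graph `B_k`: `k` triangles sharing a common edge. The common edge joins the two
vertices `inl 0` and `inl 1`; the vertices `inr i` are the remaining vertices of the triangles. -/
def bookGraph (k : ℕ) : SimpleGraph (Fin 2 ⊕ Fin k) :=
  completeBipartiteGraph (Fin 2) (Fin k) ⊔ SimpleGraph.edge (Sum.inl 0) (Sum.inl 1)

open Classical in
/-- The spectral radius `ρ(G)` of a finite graph: the largest (real) eigenvalue of its adjacency
matrix. -/
noncomputable def graphSpectralRadius {V : Type*} [Fintype V] (G : SimpleGraph V) : ℝ :=
  sSup {μ : ℝ | Module.End.HasEigenvalue (Matrix.toLin' (G.adjMatrix ℝ)) μ}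

/-- `G` is a non-bipartite graph that does not contain `H` as a (not necessarily induced)
subgraph. -/
def IsNonBipartiteFree {V W : Type*} (H : SimpleGraph W) (G : SimpleGraph V) : Prop :=
  ¬ G.IsBipartite ∧ H.Free G

open Classical in
/-- `Ex₃(n, H)`: the non-bipartite `H`-free graphs on `n` vertices with the maximum number of
edges among all non-bipartite `H`-free graphs on `n` vertices. -/
def Ex₃ {W : Type*} (n : ℕ) (H : SimpleGraph W) : Set (SimpleGraph (Fin n)) :=
  {G | G.IsExtremal (IsNonBipartiteFree H)}

/-- `Spex₃(n, H)`: the non-bipartite `H`-free graphs on `n` vertices with the maximum spectral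
radius among all non-bipartite `H`-free graphs on `n` vertices. -/
def Spex₃ {W : Type*} (n : ℕ) (H : SimpleGraph W) : Set (SimpleGraph (Fin n)) :=
  {G | IsNonBipartiteFree H G ∧ ∀ G' : SimpleGraph (Fin n), IsNonBipartiteFree H G' →
    graphSpectralRadius G' ≤ graphSpectralRadius G}

/-! Put q = ⌊(n-1)/2⌋⌊n/2⌋. For large n every non-bipartite B_{r+1}-free graph has at most q + 2r
edges (`exists_card_edgeFinset_le`), and every spectral extremal one has exactly q + 2r
(`exists_card_edgeFinset_eq`). Hence the latter is edge-extremal.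

B_{r+1}-freeness says that each edge lies in at most r triangles. By stability, such a graph with
n²/4 - n/2 - O(1) edges becomes bipartite, with parts A and B, after deletion of one vertex w
(`exists_isBipartiteOff`). If w has s neighbours in A and t in B, and μ pairs between A and B are
missing, there are |A||B| + s + t - μ edges. Non-bipartiteness gives s, t ≥ 1, and the triangles
through w then give s + t ≤ 2r + μ.

On the spectral side, let ρ be the largest spectral radius and x a nonnegative unit eigenvector.
Comparison with a balanced complete bipartite graph on n - 1 vertices plus one vertex gives ρ² ≥ q.
Counting walks of length two from a maximal entry gives ρ² ≤ e(G) + O(1), so the structure above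
applies. The Rayleigh quotient then shows that the total weight of missing pairs is at most ρ x_w²
and that ρ - √(|A||B|) ≤ 2ρ x_w² (`add_two_mul_missingWeight_le`). After possibly exchanging w with
its only neighbour in a part, x_w is O(1/n) times the maximal entry, so not even one missing pair is
affordable: all A–B pairs are edges (`exists_complete`), whence s, t ≤ r. The same inequality forces
|A||B| = q. Finally x is positive, so an added edge at w would increase ρ, and maximality gives s =
t = r. -/

open Finset

set_option linter.unusedSectionVars false

/-! ### Book-freeness as a codegree condition; double counting. -/

section Combinatorics

variable {V : Type*} [Fintype V] [DecidableEq V] {G : SimpleGraph V} [DecidableRel G.Adj]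

/-- Every edge of `G` lies in at most `r` triangles. -/
def SimpleGraph.CodegreeLE (G : SimpleGraph V) [DecidableRel G.Adj] (r : ℕ) : Prop :=
  ∀ u v, G.Adj u v → #(G.neighborFinset u ∩ G.neighborFinset v) ≤ r

theorem free_bookGraph_iff (r : ℕ) : (bookGraph (r + 1)).Free G ↔ G.CodegreeLE r := by
  constructor
  · intro h u v huv
    by_contra! hc
    obtain ⟨s, hs, hcard⟩ := Finset.exists_subset_card_eq (Nat.succ_le_of_lt hc)
    have e := s.equivFinOfCardEq hcard
    apply h
    have hN : ∀ i, G.Adj u (e.symm i) ∧ G.Adj v (e.symm i) := fun i => by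
      simpa using hs (e.symm i).2
    let f : Fin 2 ⊕ Fin (r + 1) → V := Sum.elim ![u, v] (fun i => e.symm i)
    refine ⟨⟨⟨f, ?_⟩, ?_⟩⟩
    · rintro (a | a) (b | b) hab
      · fin_cases a <;> fin_cases b <;>
          simp_all [bookGraph, f, SimpleGraph.edge_adj, SimpleGraph.adj_comm]
      · fin_cases a <;> simp [f, hN b]
      · fin_cases b <;> simp [f, (hN a).1.symm, (hN a).2.symm]
      · simp [bookGraph, SimpleGraph.edge_adj] at hab
    · rintro (a | a) (b | b) hab
      · have := huv.ne
        fin_cases a <;> fin_cases b <;> simp_all [f]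
      · have := (hN b).1.ne
        have := (hN b).2.ne
        fin_cases a <;> simp_all [f]
      · have := (hN a).1.ne'
        have := (hN a).2.ne'
        fin_cases b <;> simp_all [f]
      · simpa [f] using hab
  · rintro h ⟨f, hf⟩
    have h01 : G.Adj (f (Sum.inl 0)) (f (Sum.inl 1)) :=
      f.map_rel (by simp [bookGraph, SimpleGraph.edge_adj])
    have := h _ _ h01
    have hsub : Finset.univ.image (fun i : Fin (r + 1) => f (Sum.inr i)) ⊆
        G.neighborFinset (f (Sum.inl 0)) ∩ G.neighborFinset (f (Sum.inl 1)) := by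
      intro x hx
      obtain ⟨i, -, rfl⟩ := Finset.mem_image.1 hx
      simp only [Finset.mem_inter, SimpleGraph.mem_neighborFinset]
      exact ⟨f.map_rel (by simp [bookGraph]), f.map_rel (by simp [bookGraph])⟩
    have h2 := Finset.card_le_card hsub
    rw [Finset.card_image_of_injective _ (fun i j hij => Sum.inr_injective (hf hij))] at h2
    simp at h2
    omega

/-- Double counting of the edges between two sets of vertices. -/
theorem sum_card_neighborFinset_inter_comm (S T : Finset V) :
    ∑ i ∈ S, #(G.neighborFinset i ∩ T) = ∑ j ∈ T, #(G.neighborFinset j ∩ S) := by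
  simp only [Finset.card_eq_sum_ones, ← Finset.filter_mem_eq_inter, Finset.sum_filter,
    SimpleGraph.neighborFinset_eq_filter]
  have h : ∀ (i : V) (T : Finset V), (∑ x, if G.Adj i x then (if x ∈ T then 1 else 0) else 0) =
      ∑ x ∈ T, if G.Adj i x then 1 else 0 := by
    intro i T
    rw [← Finset.sum_subset (Finset.subset_univ T)]
    · exact Finset.sum_congr rfl fun x hx => by simp [hx]
    · intro x _ hx; simp [hx]
  simp only [h]
  rw [Finset.sum_comm]
  simp only [G.adj_comm]

/-- Double counting of the non-adjacent pairs between two sets of vertices. -/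
theorem sum_card_sdiff_neighborFinset_comm (S T : Finset V) :
    ∑ i ∈ S, #(T \ G.neighborFinset i) = ∑ j ∈ T, #(S \ G.neighborFinset j) := by
  have h1 := sum_card_neighborFinset_inter_comm (G := G) S T
  have h2 : ∀ S T : Finset V, ∑ i ∈ S, #(T \ G.neighborFinset i) +
      ∑ i ∈ S, #(G.neighborFinset i ∩ T) = #S * #T := by
    intro S T
    rw [← Finset.sum_add_distrib, Finset.sum_const_nat (m := #T)]
    intro i _
    rw [Finset.inter_comm, Finset.card_sdiff_add_card_inter]
  have h3 := h2 S T
  have h4 := h2 T S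
  rw [mul_comm] at h4
  omega

/-- Twice the degree sum of a set is controlled by the number of edges and the internal degrees. -/
theorem two_mul_sum_degree_le (S : Finset V) :
    2 * ∑ v ∈ S, G.degree v ≤ 2 * #G.edgeFinset + ∑ v ∈ S, #(G.neighborFinset v ∩ S) := by
  have h1 := G.sum_degrees_eq_twice_card_edges
  have h2 : ∑ v, G.degree v = ∑ v ∈ S, G.degree v + ∑ v ∈ Sᶜ, G.degree v :=
    (Finset.sum_add_sum_compl S _).symm
  have h3 : ∑ v ∈ Sᶜ, #(G.neighborFinset v ∩ S) ≤ ∑ v ∈ Sᶜ, G.degree v :=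
    Finset.sum_le_sum fun v _ => Finset.card_le_card Finset.inter_subset_left
  rw [sum_card_neighborFinset_inter_comm] at h3
  have h4 : ∑ v ∈ S, G.degree v =
      ∑ v ∈ S, #(G.neighborFinset v ∩ S) + ∑ v ∈ S, #(G.neighborFinset v ∩ Sᶜ) := by
    rw [← Finset.sum_add_distrib]
    refine Finset.sum_congr rfl fun v _ => ?_
    rw [← G.card_neighborFinset_eq_degree, ← Finset.sdiff_eq_inter_compl, add_comm,
      Finset.card_sdiff_add_card_inter]
  omega

end Combinatorics

/-! ### Spectral radius, Rayleigh quotient, nonnegative eigenvectors. -/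

section Spectral

variable {V : Type*} [Fintype V] [DecidableEq V]

theorem exists_mulVec_eq_smul_of_isHermitian [Nonempty V] {A : Matrix V V ℝ}
    (hA : A.IsHermitian) (i : V) :
    Module.End.HasEigenvalue (Matrix.toLin' A) (hA.eigenvalues i) := by
  refine Module.End.hasEigenvalue_of_hasEigenvector
    (x := (hA.eigenvectorBasis i : V → ℝ)) ⟨?_, ?_⟩
  · rw [Module.End.mem_eigenspace_iff, Matrix.toLin'_apply]
    exact hA.mulVec_eigenvectorBasis i
  · intro h
    exact hA.eigenvectorBasis.orthonormal.ne_zero i (by ext j; exact congrFun h j)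

variable (G : SimpleGraph V) [DecidableRel G.Adj]

/-- The definition uses classical decidability of adjacency; this trades it for the ambient
instance. -/
theorem graphSpectralRadius_eq :
    graphSpectralRadius G =
      sSup {μ : ℝ | Module.End.HasEigenvalue (Matrix.toLin' (G.adjMatrix ℝ)) μ} := by
  unfold graphSpectralRadius
  congr!

/-- The supremum is attained because the set of eigenvalues is finite and, the matrix being
symmetric, nonempty. -/
theorem hasEigenvalue_graphSpectralRadius [Nonempty V] :
    Module.End.HasEigenvalue (Matrix.toLin' (G.adjMatrix ℝ)) (graphSpectralRadius G) := by
  rw [graphSpectralRadius_eq]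
  have hA : (G.adjMatrix ℝ).IsHermitian := by
    rw [Matrix.IsHermitian, Matrix.conjTranspose_eq_transpose_of_trivial]
    exact G.isSymm_adjMatrix
  exact Set.Nonempty.csSup_mem ⟨_, exists_mulVec_eq_smul_of_isHermitian hA (Classical.arbitrary V)⟩
    (Module.End.finite_hasEigenvalue _)

/-- An eigenvalue λ of ρI - A makes ρ - λ an eigenvalue of A, hence at most ρ. -/
theorem posSemidef_graphSpectralRadius_sub [Nonempty V] :
    (graphSpectralRadius G • (1 : Matrix V V ℝ) - G.adjMatrix ℝ).PosSemidef := by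
  have hB : (graphSpectralRadius G • (1 : Matrix V V ℝ) - G.adjMatrix ℝ).IsHermitian := by
    rw [Matrix.IsHermitian, Matrix.conjTranspose_eq_transpose_of_trivial, Matrix.transpose_sub,
      Matrix.transpose_smul, Matrix.transpose_one, G.transpose_adjMatrix]
  rw [hB.posSemidef_iff_eigenvalues_nonneg]
  intro i
  obtain ⟨v, hv, hv0⟩ := (exists_mulVec_eq_smul_of_isHermitian hB i).exists_hasEigenvector
  rw [Module.End.mem_eigenspace_iff, Matrix.toLin'_apply, Matrix.sub_mulVec, Matrix.smul_mulVec,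
    Matrix.one_mulVec] at hv
  have h1 : Module.End.HasEigenvalue (Matrix.toLin' (G.adjMatrix ℝ))
      (graphSpectralRadius G - hB.eigenvalues i) := by
    refine Module.End.hasEigenvalue_of_hasEigenvector (x := v) ⟨?_, hv0⟩
    rw [Module.End.mem_eigenspace_iff, Matrix.toLin'_apply, sub_smul, ← hv]
    abel
  have h2 : graphSpectralRadius G - hB.eigenvalues i ≤ graphSpectralRadius G := by
    conv_rhs => rw [graphSpectralRadius_eq]
    exact le_csSup (Module.End.finite_hasEigenvalue _).bddAbove h1
  simpa using h2

theorem dotProduct_graphSpectralRadius_sub_mulVec (y : V → ℝ) :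
    y ⬝ᵥ ((graphSpectralRadius G • (1 : Matrix V V ℝ) - G.adjMatrix ℝ).mulVec y) =
      graphSpectralRadius G * ∑ i, y i ^ 2 - ∑ i, y i * ∑ j ∈ G.neighborFinset i, y j := by
  rw [Matrix.sub_mulVec, Matrix.smul_mulVec, Matrix.one_mulVec, dotProduct_sub, dotProduct_smul,
    smul_eq_mul]
  simp only [dotProduct, SimpleGraph.adjMatrix_mulVec_apply, sq]

/-- The Rayleigh bound for the spectral radius. -/
theorem rayleigh_le_graphSpectralRadius [Nonempty V] (y : V → ℝ) :
    ∑ i, y i * ∑ j ∈ G.neighborFinset i, y j ≤ graphSpectralRadius G * ∑ i, y i ^ 2 := by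
  have h := (posSemidef_graphSpectralRadius_sub G).dotProduct_mulVec_nonneg y
  rw [star_trivial, dotProduct_graphSpectralRadius_sub_mulVec] at h
  linarith

/-- A nonnegative unit eigenvector for the spectral radius `ρ`. -/
structure IsPerron (G : SimpleGraph V) [DecidableRel G.Adj] (ρ : ℝ) (x : V → ℝ) : Prop where
  nonneg : ∀ i, 0 ≤ x i
  unit : ∑ i, x i ^ 2 = 1
  eigen : ∀ i, ρ * x i = ∑ j ∈ G.neighborFinset i, x j

/-- Replacing an eigenvector v by |v| does not lower the Rayleigh quotient. So |v| annihilates the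
positive semidefinite form of ρI - A and lies in its kernel. Connectivity is not needed, but
positivity is not obtained. -/
theorem exists_isPerron [Nonempty V] : ∃ x, IsPerron G (graphSpectralRadius G) x := by
  obtain ⟨v, hv, hv0⟩ := (hasEigenvalue_graphSpectralRadius G).exists_hasEigenvector
  rw [Module.End.mem_eigenspace_iff, Matrix.toLin'_apply] at hv
  have hv' : ∀ i, ∑ j ∈ G.neighborFinset i, v j = graphSpectralRadius G * v i := fun i => by
    simpa [SimpleGraph.adjMatrix_mulVec_apply] using congrFun hv i
  have hpos : 0 < ∑ i, v i ^ 2 := by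
    obtain ⟨i, hi⟩ := Function.ne_iff.1 hv0
    exact Finset.sum_pos' (fun i _ => sq_nonneg _) ⟨i, Finset.mem_univ _, by
      have : v i ≠ 0 := hi
      positivity⟩
  set c := Real.sqrt (∑ i, v i ^ 2) with hc
  have hcpos : 0 < c := Real.sqrt_pos.2 hpos
  have hc2 : c ^ 2 = ∑ i, v i ^ 2 := Real.sq_sqrt hpos.le
  have hunit : ∑ i, (|v i| / c) ^ 2 = 1 := by
    simp only [div_pow, sq_abs, ← Finset.sum_div, hc2]
    exact div_self hpos.ne'
  have habs : (graphSpectralRadius G) * ∑ i, |v i| ^ 2 ≤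
      ∑ i, |v i| * ∑ j ∈ G.neighborFinset i, |v j| := by
    rw [Finset.mul_sum]
    refine Finset.sum_le_sum fun i _ => ?_
    calc graphSpectralRadius G * |v i| ^ 2 = v i * ∑ j ∈ G.neighborFinset i, v j := by
          rw [hv', sq_abs]; ring
      _ ≤ |v i * ∑ j ∈ G.neighborFinset i, v j| := le_abs_self _
      _ ≤ _ := by rw [abs_mul]; gcongr; exact Finset.abs_sum_le_sum_abs _ _
  have hzero := (posSemidef_graphSpectralRadius_sub G).dotProduct_mulVec_zero_iff (fun i => |v i|)
  rw [star_trivial, dotProduct_graphSpectralRadius_sub_mulVec] at hzero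
  have h0 := hzero.1 (by linarith [rayleigh_le_graphSpectralRadius G (fun i => |v i|)])
  refine ⟨fun i => |v i| / c, fun i => by positivity, hunit, fun i => ?_⟩
  have h1 := congrFun h0 i
  simp only [Matrix.sub_mulVec, Matrix.smul_mulVec, Matrix.one_mulVec, Pi.sub_apply, Pi.smul_apply,
    smul_eq_mul, SimpleGraph.adjMatrix_mulVec_apply, Pi.zero_apply] at h1
  rw [← Finset.sum_div, ← sub_eq_zero.1 h1]
  ring

end Spectral

/-! ### Stability: dense graphs with small codegrees are nearly complete bipartite. -/

section Stability

variable {V : Type*} [Fintype V]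

theorem sum_sum_neighborFinset {R : Type*} [CommSemiring R] (G : SimpleGraph V)
    [DecidableRel G.Adj] (f : V → R) :
    ∑ u, ∑ v ∈ G.neighborFinset u, f v = ∑ v, G.degree v * f v := by
  rw [Finset.sum_comm' (t' := Finset.univ) (s' := fun v => G.neighborFinset v)
    (by simp [G.adj_comm])]
  simp

/-- A graph with nearly `n² / 4` edges has an edge whose end vertices have large degree sum. -/
theorem exists_adj_le_degree_add_degree (G : SimpleGraph V) [DecidableRel G.Adj] (C : ℕ)
    (hC : C < Fintype.card V)
    (hm : Fintype.card V ^ 2 ≤ 4 * #G.edgeFinset + C * Fintype.card V) :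
    ∃ u v, G.Adj u v ∧ Fintype.card V ≤ G.degree u + G.degree v + C := by
  by_contra! hcon
  set n := Fintype.card V
  set m := #G.edgeFinset
  have hm0 : 0 < m := by
    rcases Nat.eq_zero_or_pos m with h | h
    · rw [h] at hm
      nlinarith
    · exact h
  -- Over ordered edges the degree sums add up to 2 Σ d², and Cauchy–Schwarz gives Σ d² ≥ 4m²/n; so
  -- small degree sums would force 4m + (C+1)n ≤ n².
  have h1 : ∑ u, ∑ v ∈ G.neighborFinset u, (G.degree u + G.degree v + (C + 1)) ≤
      ∑ u, ∑ v ∈ G.neighborFinset u, n :=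
    Finset.sum_le_sum fun u _ => Finset.sum_le_sum fun v hv =>
      hcon u v ((G.mem_neighborFinset u v).1 hv)
  have hd : ∑ v, G.degree v = 2 * m := G.sum_degrees_eq_twice_card_edges
  have h2 := sum_sum_neighborFinset G (fun v => G.degree v)
  simp only [Finset.sum_add_distrib, h2, Finset.sum_const, smul_eq_mul, G.card_neighborFinset_eq_degree,
    ← Finset.sum_mul, hd, Nat.cast_id] at h1
  have h3 := sq_sum_le_card_mul_sum_sq (s := (Finset.univ : Finset V)) (f := fun v => G.degree v)
  simp only [hd, Finset.card_univ, sq] at h3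
  set D := ∑ v, G.degree v * G.degree v
  have h4 : m * (4 * m + (C + 1) * n) ≤ m * (n * n) := by nlinarith
  have h5 := Nat.le_of_mul_le_mul_left h4 hm0
  nlinarith

variable [DecidableEq V] (G : SimpleGraph V) [DecidableRel G.Adj] (X : Finset V)

/-- The non-neighbours of `i` on the other side of the partition `X`, `Xᶜ`. -/
def missing (i : V) : Finset V := {j | ¬(i ∈ X ↔ j ∈ X) ∧ ¬G.Adj i j}

/-- The neighbours of `i` on the same side of the partition `X`, `Xᶜ`. -/
def internal (i : V) : Finset V := {j | (i ∈ X ↔ j ∈ X) ∧ G.Adj i j}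

variable {X} in
theorem missing_of_mem {i : V} (hi : i ∈ X) : missing G X i = Xᶜ \ G.neighborFinset i := by
  ext j; simp [missing, hi]

variable {X} in
theorem missing_of_notMem {i : V} (hi : i ∉ X) : missing G X i = X \ G.neighborFinset i := by
  ext j; simp [missing, hi]

variable {X} in
theorem internal_of_mem {i : V} (hi : i ∈ X) : internal G X i = G.neighborFinset i ∩ X := by
  ext j; simp [internal, hi, and_comm]

variable {X} in
theorem internal_of_notMem {i : V} (hi : i ∉ X) : internal G X i = G.neighborFinset i ∩ Xᶜ := by
  ext j; simp [internal, hi, and_comm]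

/-- At each vertex, degree plus missing equals the size of the opposite side plus internal. All sums
run over ordered pairs, hence the factors 2. -/
theorem two_mul_card_edgeFinset_add_sum_missing :
    2 * #G.edgeFinset + ∑ i, #(missing G X i) = 2 * (#X * #Xᶜ) + ∑ i, #(internal G X i) := by
  rw [← G.sum_degrees_eq_twice_card_edges, ← Finset.sum_add_distrib]
  have h : ∀ i, G.degree i + #(missing G X i) =
      #({j | ¬(i ∈ X ↔ j ∈ X)} : Finset V) + #(internal G X i) := by
    intro i
    have h1 := Finset.card_filter_add_card_filter_not (s := G.neighborFinset i)
      (fun j => (i ∈ X ↔ j ∈ X))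
    have h2 := Finset.card_filter_add_card_filter_not
      (s := ({j | ¬(i ∈ X ↔ j ∈ X)} : Finset V)) (fun j => G.Adj i j)
    have e1 : (G.neighborFinset i).filter (fun j => (i ∈ X ↔ j ∈ X)) = internal G X i := by
      ext j; simp [internal, and_comm]
    have e2 : ({j | ¬(i ∈ X ↔ j ∈ X)} : Finset V).filter (fun j => ¬ G.Adj i j) =
        missing G X i := by
      ext j; simp [missing]
    have e3 : ({j | ¬(i ∈ X ↔ j ∈ X)} : Finset V).filter (fun j => G.Adj i j) =
        (G.neighborFinset i).filter (fun j => ¬ (i ∈ X ↔ j ∈ X)) := by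
      ext j; simp [and_comm]
    rw [e1, G.card_neighborFinset_eq_degree] at h1
    rw [e2, e3] at h2
    omega
  rw [Finset.sum_congr rfl fun i _ => h i, Finset.sum_add_distrib]
  congr 1
  rw [← Finset.sum_add_sum_compl X]
  have hX : ∀ i ∈ X, #({j | ¬(i ∈ X ↔ j ∈ X)} : Finset V) = #Xᶜ := fun i hi => by
    congr 1; ext j; simp [hi]
  have hX' : ∀ i ∈ Xᶜ, #({j | ¬(i ∈ X ↔ j ∈ X)} : Finset V) = #X := fun i hi => by
    congr 1; ext j; simp [Finset.mem_compl.1 hi]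
  rw [Finset.sum_congr rfl hX, Finset.sum_congr rfl hX']
  simp
  ring

variable {G}

/-- An edge inside a side of a partition forces many missing pairs. -/
theorem card_le_missing_add_missing {r : ℕ} (hG : G.CodegreeLE r) {p q : V} (hpq : G.Adj p q)
    {O : Finset V} (hp : O \ G.neighborFinset p ⊆ missing G X p)
    (hq : O \ G.neighborFinset q ⊆ missing G X q) :
    #O ≤ #(missing G X p) + #(missing G X q) + r := by
  have h1 := hG p q hpq
  -- A vertex of `O` missed by neither end is one of the at most r common neighbours.
  have h2 : O ⊆ missing G X p ∪ missing G X q ∪ (G.neighborFinset p ∩ G.neighborFinset q) := by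
    intro z hz
    by_cases h3 : z ∈ G.neighborFinset p
    · by_cases h4 : z ∈ G.neighborFinset q
      · exact Finset.mem_union_right _ (Finset.mem_inter.2 ⟨h3, h4⟩)
      · exact Finset.mem_union_left _ (Finset.mem_union_right _ (hq (Finset.mem_sdiff.2 ⟨hz, h4⟩)))
    · exact Finset.mem_union_left _ (Finset.mem_union_left _ (hp (Finset.mem_sdiff.2 ⟨hz, h3⟩)))
  have h3 := Finset.card_le_card h2
  have h4 := Finset.card_union_le (missing G X p ∪ missing G X q)
    (G.neighborFinset p ∩ G.neighborFinset q)
  have h5 := Finset.card_union_le (missing G X p) (missing G X q)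
  omega

/-- A near-complete bipartite structure: two large independent sets with almost all edges between
them, and a small set of exceptional vertices. -/
structure IsNearComplete (G : SimpleGraph V) [DecidableRel G.Adj] (A B L : Finset V) (K : ℕ) :
    Prop where
  disjAB : Disjoint A B
  disjAL : Disjoint A L
  disjBL : Disjoint B L
  cover : ∀ i, i ∈ A ∨ i ∈ B ∨ i ∈ L
  cardL : #L ≤ K
  cardA : 48 * Fintype.card V ≤ 100 * #A
  cardB : 48 * Fintype.card V ≤ 100 * #B
  indepA : ∀ u ∈ A, ∀ v ∈ A, ¬G.Adj u v
  indepB : ∀ u ∈ B, ∀ v ∈ B, ¬G.Adj u v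
  missA : ∀ u ∈ A, 100 * #(B \ G.neighborFinset u) ≤ Fintype.card V
  missB : ∀ u ∈ B, 100 * #(A \ G.neighborFinset u) ≤ Fintype.card V

/-- For an edge uv of large degree sum, N(u) and N(v) overlap in at most r vertices, so they leave
out a set Z of at most C + r. Split along N(v): a vertex of N(v) has at most r neighbours there, a
vertex of N(u) \ N(v) has at most r + |Z| internal ones, and vertices of Z are charged n each. -/
theorem exists_sum_internal_le {r : ℕ} (hG : G.CodegreeLE r) (C : ℕ)
    (hC : C < Fintype.card V)
    (hm : Fintype.card V ^ 2 ≤ 4 * #G.edgeFinset + C * Fintype.card V) :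
    ∃ X : Finset V, ∑ i, #(internal G X i) ≤ (3 * r + 2 * C) * Fintype.card V := by
  obtain ⟨u, v, huv, hd⟩ := exists_adj_le_degree_add_degree G C hC hm
  set n := Fintype.card V with hn
  set Z : Finset V := (G.neighborFinset u ∪ G.neighborFinset v)ᶜ with hZ
  have hZc : #Z ≤ C + r := by
    have h1 := Finset.card_union_add_card_inter (G.neighborFinset u) (G.neighborFinset v)
    have h2 := hG u v huv
    simp only [G.card_neighborFinset_eq_degree] at h1
    rw [hZ, Finset.card_compl]
    omega
  refine ⟨G.neighborFinset v, ?_⟩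
  have hle : ∀ i, #(internal G (G.neighborFinset v) i) ≤
      (2 * r + C) + if i ∈ Z then n else 0 := by
    intro i
    by_cases hi : i ∈ G.neighborFinset v
    · rw [internal_of_mem G hi]
      have := hG i v ((G.mem_neighborFinset v i).1 hi).symm
      omega
    · rw [internal_of_notMem G hi]
      by_cases hiu : i ∈ G.neighborFinset u
      · have hsub : G.neighborFinset i ∩ (G.neighborFinset v)ᶜ ⊆
            (G.neighborFinset i ∩ G.neighborFinset u) ∪ Z := by
          intro j hj
          simp only [hZ, Finset.mem_inter, Finset.mem_compl, Finset.mem_union] at hj ⊢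
          tauto
        have h1 := hG i u ((G.mem_neighborFinset u i).1 hiu).symm
        have h2 := (Finset.card_le_card hsub).trans (Finset.card_union_le _ _)
        omega
      · have hiZ : i ∈ Z := by
          rw [hZ, Finset.mem_compl, Finset.mem_union]; tauto
        rw [if_pos hiZ]
        have := Finset.card_le_univ (G.neighborFinset i ∩ (G.neighborFinset v)ᶜ)
        omega
  calc ∑ i, #(internal G (G.neighborFinset v) i)
      ≤ ∑ i, ((2 * r + C) + if i ∈ Z then n else 0) := Finset.sum_le_sum fun i _ => hle i
    _ = n * (2 * r + C) + #Z * n := by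
        rw [Finset.sum_add_distrib, Finset.sum_ite_mem]; simp [hn]
    _ ≤ n * (2 * r + C) + (C + r) * n := by gcongr
    _ = _ := by ring

/-- Stability: a graph with nearly `n² / 4` edges in which every edge lies in few triangles is
close to a balanced complete bipartite graph. -/
theorem exists_isNearComplete (r C : ℕ) : ∃ K N : ℕ, ∀ {V : Type} [Fintype V] [DecidableEq V]
    (G : SimpleGraph V) [DecidableRel G.Adj], N ≤ Fintype.card V → G.CodegreeLE r →
    Fintype.card V ^ 2 ≤ 4 * #G.edgeFinset + C * Fintype.card V →
    ∃ A B L, IsNearComplete G A B L K := by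
  set D := 3 * r + 2 * C with hD
  refine ⟨100 * (C + D), 2500 * (C + 2 * D) + 20000 * (C + D) + 100 * r + 100,
    fun {V} _ _ G _ hN hG hm => ?_⟩
  obtain ⟨X, hX⟩ := exists_sum_internal_le hG C (by omega) hm
  set n := Fintype.card V with hn
  rw [← hD] at hX
  have hid := two_mul_card_edgeFinset_add_sum_missing G X
  have hab : #X + #Xᶜ = n := by rw [Finset.card_add_card_compl]
  set a := #X with ha
  set b := #Xᶜ with hb
  set m := #G.edgeFinset with hmm
  have h4ab : 4 * (a * b) ≤ n ^ 2 := by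
    rw [← hab]; zify; nlinarith [sq_nonneg ((a : ℤ) - b)]
  have hmiss : ∑ i, #(missing G X i) ≤ (C + D) * n := by nlinarith
  have hbal : n ^ 2 ≤ 4 * (a * b) + (C + 2 * D) * n := by
    nlinarith [Nat.zero_le (∑ i, #(missing G X i))]
  -- By `hmiss` only boundedly many vertices miss over 1% of n. An edge inside a side and outside
  -- `L` would have two ends that together miss almost the whole other side, so the rest of each
  -- side is independent.
  set L : Finset V := {i | n < 100 * #(missing G X i)} with hL
  have hLc : #L ≤ 100 * (C + D) := by
    have h1 : #L * n ≤ 100 * ((C + D) * n) := by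
      calc #L * n = ∑ i ∈ L, n := by simp
        _ ≤ ∑ i ∈ L, 100 * #(missing G X i) :=
            Finset.sum_le_sum fun i hi => (Finset.mem_filter.1 hi).2.le
        _ ≤ ∑ i, 100 * #(missing G X i) :=
            Finset.sum_le_sum_of_subset (Finset.subset_univ _)
        _ = 100 * ∑ i, #(missing G X i) := by rw [Finset.mul_sum]
        _ ≤ _ := by gcongr
    rw [← mul_assoc] at h1
    exact Nat.le_of_mul_le_mul_right h1 (by omega)
  -- This makes (a - b)² = n² - 4ab at most (n/50)², so both sides have at least 0.49n vertices.
  have hsq : 2500 * (C + 2 * D) * n ≤ n * n := by gcongr; omega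
  have hsize : 49 * n ≤ 100 * a ∧ 49 * n ≤ 100 * b := by
    constructor
    · by_contra! hc
      have : n + 50 * a < 50 * b := by omega
      nlinarith
    · by_contra! hc
      have : n + 50 * b < 50 * a := by omega
      nlinarith
  have hnotL : ∀ i, i ∉ L → 100 * #(missing G X i) ≤ n := fun i hi => by
    by_contra! hc
    exact hi (by simp [hL, hc])
  have hin : ∀ S : Finset V, #S ≤ #(S \ L) + 100 * (C + D) := fun S => by
    have := Finset.card_sdiff_add_card_inter S L
    have h2 := Finset.card_le_card (Finset.inter_subset_right (s₁ := S) (s₂ := L))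
    omega
  refine ⟨X \ L, Xᶜ \ L, L, ?_, Finset.sdiff_disjoint, Finset.sdiff_disjoint, ?_, hLc, ?_, ?_, ?_,
    ?_, ?_, ?_⟩
  · exact Finset.disjoint_of_subset_left Finset.sdiff_subset
      (Finset.disjoint_of_subset_right Finset.sdiff_subset disjoint_compl_right)
  · intro i
    simp only [Finset.mem_sdiff, Finset.mem_compl]
    tauto
  · have := hin X
    omega
  · have := hin Xᶜ
    omega
  · intro u hu v hv huv
    rw [Finset.mem_sdiff] at hu hv
    have h1 := card_le_missing_add_missing X hG huv (O := Xᶜ)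
      (by rw [missing_of_mem G hu.1]) (by rw [missing_of_mem G hv.1])
    have h2 := hnotL u hu.2
    have h3 := hnotL v hv.2
    omega
  · intro u hu v hv huv
    rw [Finset.mem_sdiff, Finset.mem_compl] at hu hv
    have h1 := card_le_missing_add_missing X hG huv (O := X)
      (by rw [missing_of_notMem G hu.1]) (by rw [missing_of_notMem G hv.1])
    have h2 := hnotL u hu.2
    have h3 := hnotL v hv.2
    omega
  · intro u hu
    rw [Finset.mem_sdiff] at hu
    have h1 : (Xᶜ \ L) \ G.neighborFinset u ⊆ missing G X u := by
      rw [missing_of_mem G hu.1]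
      exact Finset.sdiff_subset_sdiff Finset.sdiff_subset (Finset.Subset.refl _)
    have h2 := Finset.card_le_card h1
    have h3 := hnotL u hu.2
    omega
  · intro u hu
    rw [Finset.mem_sdiff, Finset.mem_compl] at hu
    have h1 : (X \ L) \ G.neighborFinset u ⊆ missing G X u := by
      rw [missing_of_notMem G hu.1]
      exact Finset.sdiff_subset_sdiff Finset.sdiff_subset (Finset.Subset.refl _)
    have h2 := Finset.card_le_card h1
    have h3 := hnotL u hu.2
    omega

end Stability

/-! ### One vertex meets all edges inside the sides. -/

section NearBipartite

variable {V : Type*} [Fintype V] [DecidableEq V] {G : SimpleGraph V} [DecidableRel G.Adj]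

/-- Deleting the vertex `w` leaves a bipartite graph with parts `A` and `B`. -/
structure IsBipartiteOff (G : SimpleGraph V) (w : V) (A B : Finset V) : Prop where
  notMemA : w ∉ A
  notMemB : w ∉ B
  disj : Disjoint A B
  cover : ∀ i, i = w ∨ i ∈ A ∨ i ∈ B
  indepA : ∀ u ∈ A, ∀ v ∈ A, ¬G.Adj u v
  indepB : ∀ u ∈ B, ∀ v ∈ B, ¬G.Adj u v

/-- A sum of degrees is at most twice the sum over a vertex cover. -/
theorem sum_degree_le_of_cover (L : Finset V) (h : ∀ i j, G.Adj i j → i ∈ L ∨ j ∈ L) :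
    ∑ i, G.degree i ≤ 2 * ∑ i ∈ L, G.degree i := by
  rw [← Finset.sum_add_sum_compl L, two_mul]
  refine Nat.add_le_add_left ?_ _
  calc ∑ i ∈ Lᶜ, G.degree i = ∑ i ∈ Lᶜ, #(G.neighborFinset i ∩ L) := by
        refine Finset.sum_congr rfl fun i hi => ?_
        rw [← G.card_neighborFinset_eq_degree, Finset.inter_eq_left.2]
        intro j hj
        exact (h i j ((G.mem_neighborFinset i j).1 hj)).resolve_left (Finset.mem_compl.1 hi)
    _ = ∑ j ∈ L, #(G.neighborFinset j ∩ Lᶜ) := sum_card_neighborFinset_inter_comm _ _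
    _ ≤ _ := Finset.sum_le_sum fun j _ => by
        rw [← G.card_neighborFinset_eq_degree]
        exact Finset.card_le_card Finset.inter_subset_left

/-- This is `two_mul_sum_degree_le` for the graph of missing pairs: a few vertices can carry at most
about half of the ordered count. -/
theorem two_mul_sum_missing_le (X S : Finset V) :
    2 * ∑ i ∈ S, #(missing G X i) ≤ ∑ i, #(missing G X i) + #S * #S := by
  let H : SimpleGraph V :=
    { Adj := fun i j => ¬(i ∈ X ↔ j ∈ X) ∧ ¬G.Adj i j
      symm := ⟨fun i j h => ⟨fun h' => h.1 h'.symm, fun h' => h.2 h'.symm⟩⟩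
      loopless := ⟨fun i h => h.1 Iff.rfl⟩ }
  have hdec : DecidableRel H.Adj := fun i j => inferInstanceAs (Decidable (_ ∧ _))
  have hH : ∀ i, missing G X i = H.neighborFinset i := fun i => by
    ext j; simp [missing, H]
  have h := two_mul_sum_degree_le (G := H) S
  rw [← H.sum_degrees_eq_twice_card_edges] at h
  simp only [hH, H.card_neighborFinset_eq_degree]
  refine h.trans ?_
  gcongr
  rw [← smul_eq_mul]
  exact Finset.sum_le_card_nsmul _ _ _ fun i _ => Finset.card_le_card Finset.inter_subset_right

theorem sum_internal_le_of_cover (X L : Finset V)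
    (h : ∀ i j, (i ∈ X ↔ j ∈ X) → G.Adj i j → i ∈ L ∨ j ∈ L) :
    ∑ i, #(internal G X i) ≤ 2 * ∑ i ∈ L, #(internal G X i) := by
  let H : SimpleGraph V :=
    { Adj := fun i j => (i ∈ X ↔ j ∈ X) ∧ G.Adj i j
      symm := ⟨fun i j h => ⟨h.1.symm, h.2.symm⟩⟩
      loopless := ⟨fun i h => h.2.ne rfl⟩ }
  have hdec : DecidableRel H.Adj := fun i j => inferInstanceAs (Decidable (_ ∧ _))
  have hH : ∀ i, internal G X i = H.neighborFinset i := fun i => by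
    ext j; simp [internal, H]
  simp only [hH, H.card_neighborFinset_eq_degree]
  exact sum_degree_le_of_cover L fun i j hij => h i j hij.1 hij.2

/-- A vertex adjacent to both sides of a near-complete bipartite structure has small degree. -/
theorem IsNearComplete.degree_le {r K : ℕ} {A B L : Finset V} (h : IsNearComplete G A B L K)
    (hG : G.CodegreeLE r) {t a b : V} (hb : b ∈ B) (htb : G.Adj t b) (ha : a ∈ A)
    (hta : G.Adj t a) :
    100 * G.degree t ≤ 200 * r + 2 * Fintype.card V + 100 * K := by
  -- A neighbour of t in B is either a common neighbour with a or missed by a; likewise in A with b.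
  have hsub : G.neighborFinset t ⊆ ((G.neighborFinset t ∩ G.neighborFinset a) ∪
      (B \ G.neighborFinset a)) ∪ ((G.neighborFinset t ∩ G.neighborFinset b) ∪
      (A \ G.neighborFinset b)) ∪ L := by
    intro j hj
    have := h.cover j
    simp only [Finset.mem_union, Finset.mem_inter, Finset.mem_sdiff]
    tauto
  have h1 := Finset.card_le_card hsub
  have h2 := Finset.card_union_le (((G.neighborFinset t ∩ G.neighborFinset a) ∪
      (B \ G.neighborFinset a)) ∪ ((G.neighborFinset t ∩ G.neighborFinset b) ∪
      (A \ G.neighborFinset b))) L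
  have h3 := Finset.card_union_le ((G.neighborFinset t ∩ G.neighborFinset a) ∪
      (B \ G.neighborFinset a)) ((G.neighborFinset t ∩ G.neighborFinset b) ∪
      (A \ G.neighborFinset b))
  have h4 := Finset.card_union_le (G.neighborFinset t ∩ G.neighborFinset a)
      (B \ G.neighborFinset a)
  have h5 := Finset.card_union_le (G.neighborFinset t ∩ G.neighborFinset b)
      (A \ G.neighborFinset b)
  have h6 := hG t a hta
  have h7 := hG t b htb
  have h8 := h.missA a ha
  have h9 := h.missB b hb
  have h10 := h.cardL
  rw [G.card_neighborFinset_eq_degree] at h1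
  omega

/-- The edge count allows only about n missing ordered pairs beyond the internal ones. Exceptional
vertices adjacent to both sides have low degree, so each misses nearly n/2 vertices and there is at
most one of them. Two internal edges not sharing a suitable end w would also miss too much. -/
theorem exists_forall_internal {r K C : ℕ} (hG : G.CodegreeLE r) {A B L : Finset V}
    (h : IsNearComplete G A B L K)
    (hN : 1000 * (r + K + K * K + C) + 1000 ≤ Fintype.card V)
    (hm : Fintype.card V ^ 2 ≤ 4 * #G.edgeFinset + 2 * Fintype.card V + C) :
    ∃ (w : V) (X : Finset V), ∀ p q, (p ∈ X ↔ q ∈ X) → G.Adj p q → p = w ∨ q = w := by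
  set n := Fintype.card V with hn
  -- With this placement, an internal edge at a vertex of `L` outside `T` has both ends in `L`.
  set X : Finset V := A ∪ {l ∈ L | ∃ b ∈ B, G.Adj l b} with hX
  set T : Finset V := {l ∈ L | (∃ b ∈ B, G.Adj l b) ∧ ∃ a ∈ A, G.Adj l a} with hT
  have hAX : A ⊆ X := Finset.subset_union_left
  have hBX : B ⊆ Xᶜ := by
    intro b hb
    simp only [hX, Finset.mem_compl, Finset.mem_union, Finset.mem_filter, not_or, not_and]
    exact ⟨Finset.disjoint_right.1 h.disjAB hb, fun hl =>
      absurd hl (Finset.disjoint_left.1 h.disjBL hb)⟩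
  have hTX : T ⊆ X := by
    intro t ht
    simp only [hT, Finset.mem_filter] at ht
    simp only [hX, Finset.mem_union, Finset.mem_filter]
    exact Or.inr ⟨ht.1, ht.2.1⟩
  have hTL : T ⊆ L := Finset.filter_subset _ _
  have hTK : #T ≤ K := (Finset.card_le_card hTL).trans h.cardL
  have hdT : ∀ t ∈ T, 40 * G.degree t ≤ n := by
    intro t ht
    simp only [hT, Finset.mem_filter] at ht
    obtain ⟨-, ⟨b, hb, htb⟩, a, ha, hta⟩ := ht
    have := h.degree_le hG hb htb ha hta
    omega
  have hintL : ∀ i ∈ L, #(internal G X i) ≤ K + if i ∈ T then n / 40 else 0 := by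
    intro i hi
    by_cases hiT : i ∈ T
    · rw [if_pos hiT]
      have h1 := hdT i hiT
      have h2 : #(internal G X i) ≤ G.degree i := by
        rw [← G.card_neighborFinset_eq_degree]
        refine Finset.card_le_card fun j hj => ?_
        simp only [internal, Finset.mem_filter] at hj
        exact (G.mem_neighborFinset i j).2 hj.2.2
      omega
    · rw [if_neg hiT, add_zero]
      refine (Finset.card_le_card fun j hj => ?_).trans h.cardL
      simp only [internal, Finset.mem_filter, Finset.mem_univ, true_and] at hj
      have hiA : i ∉ A := fun hA => Finset.disjoint_left.1 h.disjAL hA hi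
      rcases h.cover j with hj' | hj' | hj'
      · have hiX : i ∈ X := hj.1.2 (hAX hj')
        simp only [hX, Finset.mem_union, hiA, false_or, Finset.mem_filter] at hiX
        exact absurd (Finset.mem_filter.2 ⟨hi, hiX.2, j, hj', hj.2⟩) hiT
      · have hiX : i ∈ X := Finset.mem_union_right _ (Finset.mem_filter.2 ⟨hi, j, hj', hj.2⟩)
        exact absurd (hj.1.1 hiX) (Finset.mem_compl.1 (hBX hj'))
      · exact hj'
  have hcover : ∀ i j, (i ∈ X ↔ j ∈ X) → G.Adj i j → i ∈ L ∨ j ∈ L := by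
    intro i j hij hadj
    by_contra! hc
    rcases h.cover i with hi | hi | hi <;> rcases h.cover j with hj | hj | hj
    · exact h.indepA i hi j hj hadj
    · exact Finset.mem_compl.1 (hBX hj) (hij.1 (hAX hi))
    · exact hc.2 hj
    · exact Finset.mem_compl.1 (hBX hi) (hij.2 (hAX hj))
    · exact h.indepB i hi j hj hadj
    · exact hc.2 hj
    all_goals exact hc.1 hi
  have hint : ∑ i, #(internal G X i) ≤ 2 * (K * K + #T * (n / 40)) := by
    refine (sum_internal_le_of_cover X L hcover).trans ?_
    gcongr
    calc ∑ i ∈ L, #(internal G X i) ≤ ∑ i ∈ L, (K + if i ∈ T then n / 40 else 0) :=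
          Finset.sum_le_sum hintL
      _ = #L * K + #T * (n / 40) := by
          rw [Finset.sum_add_distrib, Finset.sum_ite_mem, Finset.inter_eq_right.2 hTL]; simp
      _ ≤ _ := by gcongr; exact h.cardL
  have hid := two_mul_card_edgeFinset_add_sum_missing G X
  have hab : 4 * (#X * #Xᶜ) ≤ n ^ 2 := by
    rw [hn, ← Finset.card_add_card_compl X]
    zify; nlinarith [sq_nonneg ((#X : ℤ) - #Xᶜ)]
  have hTT : #T * #T ≤ K * K := Nat.mul_le_mul hTK hTK
  have hcA := h.cardA
  have hcB := h.cardB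
  have hT1 : #T ≤ 1 := by
    by_contra! hT2
    have h1 := two_mul_sum_missing_le (G := G) X T
    have h2 : #T * (45 * n) ≤ 100 * ∑ i ∈ T, #(missing G X i) := by
      rw [← smul_eq_mul, Finset.mul_sum]
      refine Finset.card_nsmul_le_sum _ _ _ fun t ht => ?_
      have h3 := hdT t ht
      rw [missing_of_mem G (hTX ht)]
      have h4 := Finset.card_le_card
        (Finset.sdiff_subset_sdiff hBX (Finset.Subset.refl (G.neighborFinset t)))
      have h5 := Finset.le_card_sdiff (G.neighborFinset t) B
      rw [G.card_neighborFinset_eq_degree] at h5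
      omega
    have h6 : 40 * (#T * (n / 40)) ≤ #T * n := by
      calc 40 * (#T * (n / 40)) = #T * (40 * (n / 40)) := by ring
        _ ≤ _ := by gcongr; exact Nat.mul_div_le n 40
    have h7 : 2 * n ≤ #T * n := by gcongr; exact hT2
    have h8 : #T * (45 * n) = 45 * (#T * n) := by ring
    generalize #T * (n / 40) = P at *
    generalize #T * n = Q at *
    omega
  have hedge : ∀ p q, (p ∈ X ↔ q ∈ X) → G.Adj p q →
      48 * n ≤ 100 * (#(missing G X p) + #(missing G X q) + r) := by
    intro p q hpq hadj
    by_cases hp : p ∈ X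
    · have h1 := card_le_missing_add_missing X hG hadj (O := Xᶜ)
        (by rw [missing_of_mem G hp]) (by rw [missing_of_mem G (hpq.1 hp)])
      have h2 := Finset.card_le_card hBX
      omega
    · have h1 := card_le_missing_add_missing X hG hadj (O := X)
        (by rw [missing_of_notMem G hp])
        (by rw [missing_of_notMem G (fun hq => hp (hpq.2 hq))])
      have h2 := Finset.card_le_card hAX
      omega
  by_contra! hcon
  -- The worse end of some internal edge misses about 0.24n. An internal edge avoiding it adds
  -- another 0.48n, while about 0.53n is the limit.
  have hw : ∃ w, 48 * n ≤ 100 * (2 * #(missing G X w) + r) := by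
    have hne : Nonempty V := Fintype.card_pos_iff.1 (by omega)
    obtain ⟨p, q, hpq, hadj, -, -⟩ := hcon (Classical.arbitrary V) X
    have := hedge p q hpq hadj
    rcases le_total #(missing G X p) #(missing G X q) with h1 | h1
    · exact ⟨q, by omega⟩
    · exact ⟨p, by omega⟩
  obtain ⟨w, hw⟩ := hw
  obtain ⟨p, q, hpq, hadj, hpw, hqw⟩ := hcon w X
  have h1 := hedge p q hpq hadj
  have h2 := two_mul_sum_missing_le (G := G) X {w, p, q}
  rw [Finset.sum_insert (by simp [hpw.symm, hqw.symm]), Finset.sum_pair hadj.ne,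
    Finset.card_insert_of_notMem (by simp [hpw.symm, hqw.symm]), Finset.card_pair hadj.ne] at h2
  have h3 : #T * (n / 40) ≤ n / 40 := by
    calc #T * (n / 40) ≤ 1 * (n / 40) := by gcongr
      _ = _ := one_mul _
  omega

theorem exists_isBipartiteOff_of_isNearComplete {r K C : ℕ} (hG : G.CodegreeLE r)
    {A B L : Finset V} (h : IsNearComplete G A B L K)
    (hN : 1000 * (r + K + K * K + C) + 1000 ≤ Fintype.card V)
    (hm : Fintype.card V ^ 2 ≤ 4 * #G.edgeFinset + 2 * Fintype.card V + C) :
    ∃ w A' B', IsBipartiteOff G w A' B' := by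
  obtain ⟨w, X, hX⟩ := exists_forall_internal hG h hN hm
  refine ⟨w, X.erase w, Xᶜ.erase w, by simp, by simp, ?_, ?_, ?_, ?_⟩
  · exact Finset.disjoint_of_subset_left (Finset.erase_subset _ _)
      (Finset.disjoint_of_subset_right (Finset.erase_subset _ _) disjoint_compl_right)
  · intro i
    simp only [Finset.mem_erase, Finset.mem_compl]
    tauto
  · intro u hu v hv huv
    rw [Finset.mem_erase] at hu hv
    have := hX u v (by tauto) huv
    tauto
  · intro u hu v hv huv
    rw [Finset.mem_erase, Finset.mem_compl] at hu hv
    have := hX u v (by tauto) huv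
    tauto

/-- A non-extremal number of lost edges forces a dense graph with few triangles on each edge to be
bipartite up to one vertex. -/
theorem exists_isBipartiteOff (r C : ℕ) : ∃ N : ℕ, ∀ {V : Type} [Fintype V] [DecidableEq V]
    (G : SimpleGraph V) [DecidableRel G.Adj], N ≤ Fintype.card V → G.CodegreeLE r →
    Fintype.card V ^ 2 ≤ 4 * #G.edgeFinset + 2 * Fintype.card V + C →
    ∃ w A B, IsBipartiteOff G w A B := by
  -- For n ≥ C the error 2n + C is at most 3n.
  obtain ⟨K, N, hK⟩ := exists_isNearComplete r 3
  refine ⟨max (N + C) (1000 * (r + K + K * K + C) + 1000), fun {V} _ _ G _ hN hG hm => ?_⟩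
  have h1 := (le_max_left _ _).trans hN
  obtain ⟨A, B, L, h⟩ := hK G (by omega) hG (by omega)
  exact exists_isBipartiteOff_of_isNearComplete hG h ((le_max_right _ _).trans hN) hm

end NearBipartite

/-! ### The edge bound q + 2r. -/

section EdgeBound

variable {V : Type*} [Fintype V] [DecidableEq V] {G : SimpleGraph V} [DecidableRel G.Adj]

namespace IsBipartiteOff

variable {w : V} {A B : Finset V}

theorem symm (h : IsBipartiteOff G w A B) : IsBipartiteOff G w B A :=
  ⟨h.notMemB, h.notMemA, h.disj.symm, fun i => by have := h.cover i; tauto, h.indepB, h.indepA⟩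

theorem sum_univ {M : Type*} [AddCommMonoid M] (h : IsBipartiteOff G w A B) (f : V → M) :
    ∑ i, f i = f w + (∑ i ∈ A, f i + ∑ i ∈ B, f i) := by
  rw [← Finset.sum_union h.disj, ← Finset.sum_insert (by simp [h.notMemA, h.notMemB])]
  refine Finset.sum_congr ?_ fun _ _ => rfl
  ext i
  have := h.cover i
  simp only [Finset.mem_univ, Finset.mem_insert, Finset.mem_union, true_iff]
  exact this

theorem card_add_card (h : IsBipartiteOff G w A B) : #A + #B + 1 = Fintype.card V := by
  have := h.sum_univ (fun _ => 1)
  simp only [Finset.sum_const, smul_eq_mul, mul_one, Finset.card_univ] at this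
  omega

theorem sum_neighborFinset_center {M : Type*} [AddCommMonoid M] (h : IsBipartiteOff G w A B)
    (f : V → M) : ∑ j ∈ G.neighborFinset w, f j =
      ∑ j ∈ G.neighborFinset w ∩ A, f j + ∑ j ∈ G.neighborFinset w ∩ B, f j := by
  rw [← Finset.sum_union (Finset.disjoint_of_subset_left Finset.inter_subset_right
    (Finset.disjoint_of_subset_right Finset.inter_subset_right h.disj)),
    ← Finset.inter_union_distrib_left]
  refine Finset.sum_congr ?_ fun _ _ => rfl
  ext j
  have := h.cover j
  simp only [SimpleGraph.mem_neighborFinset, Finset.mem_inter, Finset.mem_union]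
  refine ⟨fun hj => ⟨hj, this.resolve_left hj.ne'⟩, fun hj => hj.1⟩

theorem sum_neighborFinset_of_mem {M : Type*} [AddCommMonoid M] (h : IsBipartiteOff G w A B)
    (f : V → M) {i : V} (hi : i ∈ A) : ∑ j ∈ G.neighborFinset i, f j =
      ∑ j ∈ G.neighborFinset i ∩ B, f j + if i ∈ G.neighborFinset w then f w else 0 := by
  have hsub : ∀ j ∈ G.neighborFinset i, j = w ∨ j ∈ B := fun j hj => by
    have h1 := h.cover j
    have h2 := h.indepA i hi j
    rw [SimpleGraph.mem_neighborFinset] at hj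
    tauto
  by_cases hw : i ∈ G.neighborFinset w
  · rw [if_pos hw, add_comm, ← Finset.sum_insert (by simp [h.notMemB])]
    refine Finset.sum_congr ?_ fun _ _ => rfl
    ext j
    have := hsub j
    rw [SimpleGraph.mem_neighborFinset] at hw
    simp only [Finset.mem_insert, Finset.mem_inter]
    refine ⟨by tauto, ?_⟩
    rintro (rfl | hj)
    · rw [SimpleGraph.mem_neighborFinset]; exact hw.symm
    · exact hj.1
  · rw [if_neg hw, add_zero]
    refine Finset.sum_congr (Finset.inter_eq_left.2 fun j hj => ?_).symm fun _ _ => rfl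
    rcases hsub j hj with rfl | h1
    · rw [SimpleGraph.mem_neighborFinset] at hw hj
      exact absurd hj.symm hw
    · exact h1

theorem sum_card_add_sum_card : ∑ i ∈ A, #(G.neighborFinset i ∩ B) +
    ∑ i ∈ A, #(B \ G.neighborFinset i) = #A * #B := by
  rw [← Finset.sum_add_distrib, Finset.sum_const_nat (m := #B)]
  intro i _
  rw [Finset.inter_comm, Finset.card_inter_add_card_sdiff]

theorem sum_degree (h : IsBipartiteOff G w A B) : ∑ i ∈ A, G.degree i =
    ∑ i ∈ A, #(G.neighborFinset i ∩ B) + #(G.neighborFinset w ∩ A) := by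
  have h1 : ∀ i ∈ A, G.degree i =
      #(G.neighborFinset i ∩ B) + if i ∈ G.neighborFinset w then 1 else 0 := fun i hi => by
    have := h.sum_neighborFinset_of_mem (fun _ => 1) hi
    simpa using this
  rw [Finset.sum_congr rfl h1, Finset.sum_add_distrib, Finset.sum_ite_mem, Finset.inter_comm]
  simp

/-- The number of edges in terms of the number of missing pairs. -/
theorem card_edgeFinset_add (h : IsBipartiteOff G w A B) :
    #G.edgeFinset + ∑ i ∈ A, #(B \ G.neighborFinset i) =
      #A * #B + #(G.neighborFinset w ∩ A) + #(G.neighborFinset w ∩ B) := by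
  have h1 := h.sum_univ (fun i => G.degree i)
  have h2 := G.sum_degrees_eq_twice_card_edges
  have h3 := h.sum_degree
  have h4 := h.symm.sum_degree
  have h5 := h.sum_neighborFinset_center (fun _ => 1)
  have h6 := sum_card_add_sum_card (G := G) (A := A) (B := B)
  rw [sum_card_neighborFinset_inter_comm] at h4
  simp only [Finset.sum_const, smul_eq_mul, mul_one, G.card_neighborFinset_eq_degree] at h5
  omega

/-- Otherwise w could join A. With `symm` this gives a neighbour in each part. -/
theorem one_le_card_inter (h : IsBipartiteOff G w A B) (hG : ¬G.IsBipartite) :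
    1 ≤ #(G.neighborFinset w ∩ A) := by
  by_contra! hc
  apply hG
  have h0 : G.neighborFinset w ∩ A = ∅ := Finset.card_eq_zero.1 (by omega)
  have hwA : ∀ a ∈ A, ¬G.Adj w a := fun a ha hadj =>
    (Finset.notMem_empty a) (h0 ▸ Finset.mem_inter.2 ⟨(G.mem_neighborFinset w a).2 hadj, ha⟩)
  refine ⟨SimpleGraph.Coloring.mk (fun i => if i ∈ B then (1 : Fin 2) else 0) ?_⟩
  intro i j hij
  have hi := h.cover i
  have hj := h.cover j
  by_cases hiB : i ∈ B
  · have : j ∉ B := fun hjB => h.indepB i hiB j hjB hij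
    simp [hiB, this]
  · by_cases hjB : j ∈ B
    · simp [hiB, hjB]
    · exfalso
      rcases hi with rfl | hi | hi <;> rcases hj with rfl | hj | hj
      · exact hij.ne rfl
      · exact hwA j hj hij
      · exact hjB hj
      · exact hwA i hi hij.symm
      · exact h.indepA i hi j hj hij
      · exact hjB hj
      all_goals exact hiB hi

/-- Each neighbour j of w in B has at most r common neighbours with w, so it misses at least s - r
of the s neighbours of w in A. -/
theorem mul_le_missing (hG : G.CodegreeLE r) :
    #(G.neighborFinset w ∩ B) * #(G.neighborFinset w ∩ A) ≤
      ∑ i ∈ A, #(B \ G.neighborFinset i) + #(G.neighborFinset w ∩ B) * r := by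
  rw [sum_card_sdiff_neighborFinset_comm]
  calc #(G.neighborFinset w ∩ B) * #(G.neighborFinset w ∩ A)
      = ∑ j ∈ G.neighborFinset w ∩ B, #(G.neighborFinset w ∩ A) := by simp
    _ ≤ ∑ j ∈ G.neighborFinset w ∩ B, (#(A \ G.neighborFinset j) + r) := by
        refine Finset.sum_le_sum fun j hj => ?_
        have hwj : G.Adj w j := by simpa using (Finset.mem_inter.1 hj).1
        have h1 := hG w j hwj
        have h2 : G.neighborFinset w ∩ A ⊆
            (A \ G.neighborFinset j) ∪ (G.neighborFinset w ∩ G.neighborFinset j) := by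
          intro z hz
          simp only [Finset.mem_union, Finset.mem_inter, Finset.mem_sdiff] at hz ⊢
          tauto
        have h3 := (Finset.card_le_card h2).trans (Finset.card_union_le _ _)
        omega
    _ = ∑ j ∈ G.neighborFinset w ∩ B, #(A \ G.neighborFinset j) +
          #(G.neighborFinset w ∩ B) * r := by
        rw [Finset.sum_add_distrib]; simp
    _ ≤ _ := by
        gcongr
        exact Finset.inter_subset_right

end IsBipartiteOff

theorem mul_le_half_mul_half {a b n : ℕ} (h : a + b + 1 = n) : a * b ≤ (n - 1) / 2 * (n / 2) := by
  rcases Nat.even_or_odd' n with ⟨k, rfl | rfl⟩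
  · have h1 : (2 * k - 1) / 2 = k - 1 := by omega
    have h2 : 2 * k / 2 = k := by omega
    rw [h1, h2]
    obtain ⟨l, rfl⟩ : ∃ l, k = l + 1 := ⟨k - 1, by omega⟩
    have h3 : b = 2 * l + 1 - a := by omega
    rcases le_total a l with h4 | h4
    · obtain ⟨c, rfl⟩ := Nat.exists_eq_add_of_le h4
      obtain rfl : b = a + 2 * c + 1 := by omega
      simp only [Nat.add_sub_cancel]; nlinarith
    · obtain ⟨c, rfl⟩ := Nat.exists_eq_add_of_le h4
      have h5 : b + c = l + 1 := by omega
      simp only [Nat.add_sub_cancel]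
      obtain rfl | hc := Nat.eq_zero_or_pos c
      · obtain rfl : b = l + 1 := by omega
        simp
      · nlinarith
  · have h1 : (2 * k + 1 - 1) / 2 = k := by omega
    have h2 : (2 * k + 1) / 2 = k := by omega
    rw [h1, h2]
    have h3 : a + b = 2 * k := by omega
    zify at h3 ⊢
    nlinarith [sq_nonneg ((a : ℤ) - b)]

/-- Converts bounds by q into the hypothesis of the stability results. -/
theorem sq_le_four_mul_half_mul_half (n : ℕ) : n ^ 2 ≤ 4 * ((n - 1) / 2 * (n / 2)) + 2 * n := by
  rcases Nat.even_or_odd' n with ⟨k, rfl | rfl⟩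
  · have h1 : (2 * k - 1) / 2 = k - 1 := by omega
    have h2 : 2 * k / 2 = k := by omega
    rw [h1, h2]
    rcases k with _ | k
    · simp
    · simp only [Nat.add_sub_cancel]; nlinarith
  · have h1 : (2 * k + 1 - 1) / 2 = k := by omega
    have h2 : (2 * k + 1) / 2 = k := by omega
    rw [h1, h2]
    nlinarith

/-- If t = r + e + 1 exceeds r, then μ ≥ s(e + 1) ≥ s + e as s ≥ 1, and the remaining r + 1 is at
most 2r. Symmetrically for s; otherwise s + t ≤ 2r. -/
theorem add_le_two_mul_add {r s t μ : ℕ} (hr : 1 ≤ r) (hs : 1 ≤ s) (ht : 1 ≤ t)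
    (h1 : t * s ≤ μ + t * r) (h2 : s * t ≤ μ + s * r) : s + t ≤ 2 * r + μ := by
  obtain ⟨c, rfl⟩ := Nat.exists_eq_add_of_le' hs
  obtain ⟨d, rfl⟩ := Nat.exists_eq_add_of_le' ht
  by_cases hs : c + 1 ≤ r
  · by_cases ht : d + 1 ≤ r
    · omega
    · obtain ⟨e, rfl⟩ : ∃ e, d = r + e := ⟨d - r, by omega⟩
      nlinarith [Nat.zero_le (c * e)]
  · obtain ⟨e, rfl⟩ : ∃ e, c = r + e := ⟨c - r, by omega⟩
    nlinarith [Nat.zero_le (d * e)]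

/-- The edge bound for non-bipartite graphs that become bipartite by deleting one vertex. -/
theorem IsBipartiteOff.card_edgeFinset_le {r : ℕ} (hr : 1 ≤ r) (hG : G.CodegreeLE r)
    (hnb : ¬G.IsBipartite) {w : V} {A B : Finset V} (h : IsBipartiteOff G w A B) :
    #G.edgeFinset ≤ (Fintype.card V - 1) / 2 * (Fintype.card V / 2) + 2 * r := by
  have h1 := h.card_edgeFinset_add
  have h2 := mul_le_missing (w := w) (A := A) (B := B) hG
  have h3 := mul_le_missing (w := w) (A := B) (B := A) hG
  rw [sum_card_sdiff_neighborFinset_comm] at h3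
  have h4 := h.one_le_card_inter hnb
  have h5 := h.symm.one_le_card_inter hnb
  have h6 := mul_le_half_mul_half h.card_add_card
  set s := #(G.neighborFinset w ∩ A)
  set t := #(G.neighborFinset w ∩ B)
  set μ := ∑ i ∈ A, #(B \ G.neighborFinset i)
  suffices h7 : s + t ≤ 2 * r + μ by omega
  rw [mul_comm s t] at h3
  exact add_le_two_mul_add hr h4 h5 h2 (by linarith)

/-- The edge bound for non-bipartite graphs in which every edge lies in at most `r` triangles. -/
theorem exists_card_edgeFinset_le {r : ℕ} (hr : 1 ≤ r) : ∃ N : ℕ, ∀ {V : Type} [Fintype V]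
    [DecidableEq V] (G : SimpleGraph V) [DecidableRel G.Adj], N ≤ Fintype.card V →
    G.CodegreeLE r → ¬G.IsBipartite →
    #G.edgeFinset ≤ (Fintype.card V - 1) / 2 * (Fintype.card V / 2) + 2 * r := by
  obtain ⟨N, hN⟩ := exists_isBipartiteOff r 0
  refine ⟨N, fun {V} _ _ G _ hn hG hnb => ?_⟩
  by_contra! hc
  have h1 := sq_le_four_mul_half_mul_half (Fintype.card V)
  obtain ⟨w, A, B, h⟩ := hN G hn hG (by omega)
  exact absurd (h.card_edgeFinset_le hr hG hnb) (by omega)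

end EdgeBound

/-! ### A large spectral radius forces many edges. -/

section SpectralToEdges

variable {V : Type*} [Fintype V] [DecidableEq V] {G : SimpleGraph V} [DecidableRel G.Adj]
  {ρ : ℝ} {x : V → ℝ}

namespace IsPerron

theorem exists_max (h : IsPerron G ρ x) : ∃ u, 0 < x u ∧ ∀ i, x i ≤ x u := by
  have hne : Nonempty V := by
    by_contra hc
    rw [not_nonempty_iff] at hc
    simpa using h.unit
  obtain ⟨u, hu⟩ := Finite.exists_max x
  refine ⟨u, lt_of_le_of_ne (h.nonneg u) fun h0 => ?_, hu⟩
  have h1 : ∀ i, x i = 0 := fun i => le_antisymm (h0 ▸ hu i) (h.nonneg i)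
  simpa [h1] using h.unit

theorem le_degree (h : IsPerron G ρ x) {u : V} (hu : 0 < x u) (hmax : ∀ i, x i ≤ x u) :
    ρ ≤ G.degree u := by
  refine le_of_mul_le_mul_right ?_ hu
  rw [h.eigen, ← G.card_neighborFinset_eq_degree, ← nsmul_eq_mul]
  exact Finset.sum_le_card_nsmul _ _ _ fun i _ => hmax i

theorem sq_le_sum_degree (h : IsPerron G ρ x) {u : V} (hu : 0 < x u) (hmax : ∀ i, x i ≤ x u) :
    ρ ^ 2 ≤ ∑ v ∈ G.neighborFinset u, (G.degree v : ℝ) := by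
  refine le_of_mul_le_mul_right ?_ hu
  rw [sq, mul_assoc, h.eigen, Finset.mul_sum, Finset.sum_mul]
  refine Finset.sum_le_sum fun v _ => ?_
  rw [h.eigen, ← G.card_neighborFinset_eq_degree, ← nsmul_eq_mul]
  exact Finset.sum_le_card_nsmul _ _ _ fun i _ => hmax i

/-- Two eigenvector steps from a maximal entry bound ρ² by the degree sum over N(u), which is at
most e(G) plus the number of edges inside N(u). -/
theorem two_mul_sq_le (h : IsPerron G ρ x) {u : V} (hu : 0 < x u) (hmax : ∀ i, x i ≤ x u) :
    2 * ρ ^ 2 ≤ 2 * #G.edgeFinset +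
      (∑ v ∈ G.neighborFinset u, #(G.neighborFinset v ∩ G.neighborFinset u) : ℕ) := by
  have h1 := h.sq_le_sum_degree hu hmax
  have h2 := two_mul_sum_degree_le (G := G) (G.neighborFinset u)
  have h3 : (2 * ∑ v ∈ G.neighborFinset u, (G.degree v : ℝ)) ≤ 2 * #G.edgeFinset +
      (∑ v ∈ G.neighborFinset u, #(G.neighborFinset v ∩ G.neighborFinset u) : ℕ) := by
    exact_mod_cast h2
  linarith

theorem two_mul_sq_le_of_codegreeLE (h : IsPerron G ρ x) {r : ℕ} (hG : G.CodegreeLE r) :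
    2 * ρ ^ 2 ≤ 2 * #G.edgeFinset + r * Fintype.card V := by
  obtain ⟨u, hu, hmax⟩ := h.exists_max
  have h1 := h.two_mul_sq_le hu hmax
  have h2 : ∑ v ∈ G.neighborFinset u, #(G.neighborFinset v ∩ G.neighborFinset u) ≤
      r * Fintype.card V := by
    calc ∑ v ∈ G.neighborFinset u, #(G.neighborFinset v ∩ G.neighborFinset u)
        ≤ ∑ v ∈ G.neighborFinset u, r := Finset.sum_le_sum fun v hv =>
          hG v u ((G.mem_neighborFinset u v).1 hv).symm
      _ = #(G.neighborFinset u) * r := by simp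
      _ ≤ Fintype.card V * r := by gcongr; exact Finset.card_le_univ _
      _ = _ := mul_comm _ _
  have h3 : ((∑ v ∈ G.neighborFinset u, #(G.neighborFinset v ∩ G.neighborFinset u) : ℕ) : ℝ) ≤
      r * Fintype.card V := by exact_mod_cast h2
  linarith

end IsPerron

/-- If a neighbourhood is independent outside `L`, it spans few edges. -/
theorem sum_card_neighborFinset_inter_le {r K : ℕ} (hG : G.CodegreeLE r) (u : V) {B L : Finset V}
    (hB : ∀ i ∈ B, ∀ j ∈ B, ¬G.Adj i j) (hL : #L ≤ K)
    (hsub : ∀ i ∈ G.neighborFinset u, i ∈ B ∨ i ∈ L) :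
    ∑ v ∈ G.neighborFinset u, #(G.neighborFinset v ∩ G.neighborFinset u) ≤ 2 * (r * K) := by
  set S := G.neighborFinset u with hS
  have hr : ∀ v ∈ S, #(G.neighborFinset v ∩ S) ≤ r := fun v hv =>
    hG v u ((G.mem_neighborFinset u v).1 hv).symm
  have hcard : #(S ∩ L) ≤ K := (Finset.card_le_card Finset.inter_subset_right).trans hL
  have h1 : ∑ v ∈ S ∩ L, #(G.neighborFinset v ∩ S) ≤ r * K := by
    calc _ ≤ ∑ v ∈ S ∩ L, r := Finset.sum_le_sum fun v hv => hr v (Finset.mem_inter.1 hv).1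
      _ = #(S ∩ L) * r := by simp
      _ ≤ K * r := by gcongr
      _ = _ := mul_comm _ _
  -- Outside `L` the neighbourhood lies in the independent set, so these edges all end in `S ∩ L`
  -- and can be counted from there.
  have h2 : ∑ v ∈ S \ L, #(G.neighborFinset v ∩ S) ≤ r * K := by
    calc _ = ∑ v ∈ S \ L, #(G.neighborFinset v ∩ (S ∩ L)) := by
          refine Finset.sum_congr rfl fun v hv => ?_
          congr 1
          rw [Finset.mem_sdiff] at hv
          have hvB := (hsub v hv.1).resolve_right hv.2
          ext j
          have h3 := hsub j
          have h4 := hB v hvB j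
          simp only [Finset.mem_inter, SimpleGraph.mem_neighborFinset] at *
          tauto
      _ = ∑ l ∈ S ∩ L, #(G.neighborFinset l ∩ (S \ L)) := sum_card_neighborFinset_inter_comm _ _
      _ ≤ ∑ l ∈ S ∩ L, r := Finset.sum_le_sum fun l hl =>
          (Finset.card_le_card (Finset.inter_subset_inter_left Finset.sdiff_subset)).trans
            (hr l (Finset.mem_inter.1 hl).1)
      _ = #(S ∩ L) * r := by simp
      _ ≤ K * r := by gcongr
      _ = _ := mul_comm _ _
  have h3 := Finset.sum_inter_add_sum_sdiff S L (fun v => #(G.neighborFinset v ∩ S))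
  omega

/-- A graph with large spectral radius in which every edge lies in few triangles has many edges. -/
theorem exists_le_card_edgeFinset_add (r : ℕ) : ∃ C N : ℕ, ∀ {V : Type} [Fintype V]
    [DecidableEq V] (G : SimpleGraph V) [DecidableRel G.Adj] {ρ : ℝ} {x : V → ℝ},
    N ≤ Fintype.card V → G.CodegreeLE r → IsPerron G ρ x → 0 ≤ ρ →
    (((Fintype.card V - 1) / 2 * (Fintype.card V / 2) : ℕ) : ℝ) ≤ ρ ^ 2 →
    (Fintype.card V - 1) / 2 * (Fintype.card V / 2) ≤ #G.edgeFinset + C := by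
  -- The crude bound 2ρ² ≤ 2e + rn costs 2rn in 4e, and replacing 4q by n² costs 2n. The structure
  -- obtained then improves the error to a constant.
  obtain ⟨K, N, hK⟩ := exists_isNearComplete r (2 * r + 2)
  refine ⟨r * K, N + 100 * r + 100 * K + 100, fun {V} _ _ G _ ρ x hn hG hx hρ hq => ?_⟩
  have hq4 := sq_le_four_mul_half_mul_half (Fintype.card V)
  set n := Fintype.card V with hnV
  set q := (n - 1) / 2 * (n / 2) with hqd
  have h1 := hx.two_mul_sq_le_of_codegreeLE hG
  have h2 : 2 * q ≤ 2 * #G.edgeFinset + r * n := by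
    have : (2 * q : ℝ) ≤ 2 * #G.edgeFinset + r * n := by linarith
    exact_mod_cast this
  obtain ⟨A, B, L, h⟩ := hK G (by omega) hG (by rw [← hnV]; nlinarith)
  obtain ⟨u, hu, hmax⟩ := hx.exists_max
  have h3 : ∑ v ∈ G.neighborFinset u, #(G.neighborFinset v ∩ G.neighborFinset u) ≤
      2 * (r * K) := by
    by_cases hb : ∃ b ∈ B, G.Adj u b
    · by_cases ha : ∃ a ∈ A, G.Adj u a
      -- Being adjacent to both sides would give u degree at most n/10, yet its degree is at least ρ
      -- ≥ √q.
      · exfalso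
        obtain ⟨b, hb, hub⟩ := hb
        obtain ⟨a, ha, hua⟩ := ha
        have h4 := h.degree_le hG hb hub ha hua
        have h5 := hx.le_degree hu hmax
        have h6 : q ≤ G.degree u ^ 2 := by
          have : (q : ℝ) ≤ (G.degree u : ℝ) ^ 2 := hq.trans (by gcongr)
          exact_mod_cast this
        have h7 : 10 * G.degree u ≤ n := by omega
        have h8 : 100 ≤ n := by omega
        nlinarith
      · refine sum_card_neighborFinset_inter_le hG u h.indepB h.cardL fun i hi => ?_
        rw [SimpleGraph.mem_neighborFinset] at hi
        have h4 := h.cover i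
        push Not at ha
        have h5 := ha i
        tauto
    · refine sum_card_neighborFinset_inter_le hG u h.indepA h.cardL fun i hi => ?_
      rw [SimpleGraph.mem_neighborFinset] at hi
      have h4 := h.cover i
      push Not at hb
      have h5 := hb i
      tauto
  have h4 := hx.two_mul_sq_le hu hmax
  have h5 : ((∑ v ∈ G.neighborFinset u, #(G.neighborFinset v ∩ G.neighborFinset u) : ℕ) : ℝ) ≤
      2 * (r * K) := by exact_mod_cast h3
  have h6 : (q : ℝ) ≤ #G.edgeFinset + r * K := by linarith
  exact_mod_cast h6

end SpectralToEdges

/-! ### Weight of the missing pairs against the entry of the centre. -/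

section SpectralFinal

variable {V : Type*} [Fintype V] [DecidableEq V] {G : SimpleGraph V} [DecidableRel G.Adj]
  {ρ : ℝ} {x : V → ℝ} {w : V} {A B : Finset V}

/-- The total weight `x i * x j` of the non-adjacent pairs between `A` and `B`. -/
noncomputable def missingWeight (G : SimpleGraph V) [DecidableRel G.Adj] (x : V → ℝ)
    (A B : Finset V) : ℝ := ∑ i ∈ A, ∑ j ∈ B \ G.neighborFinset i, x i * x j

theorem missingWeight_comm (x : V → ℝ) (A B : Finset V) :
    missingWeight G x A B = missingWeight G x B A := by
  unfold missingWeight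
  rw [Finset.sum_comm' (t' := B) (s' := fun j => A \ G.neighborFinset j)
    (by intro i j; simp [G.adj_comm i j]; tauto)]
  exact Finset.sum_congr rfl fun _ _ => Finset.sum_congr rfl fun _ _ => mul_comm _ _

/-- The Rayleigh bound for the complete bipartite graph on A and B: Cauchy–Schwarz on each side,
then AM–GM. -/
theorem two_mul_sum_mul_sum_le (x : V → ℝ) (A B : Finset V) :
    2 * ((∑ i ∈ A, x i) * ∑ j ∈ B, x j) ≤
      √((#A : ℝ) * #B) * (∑ i ∈ A, x i ^ 2 + ∑ j ∈ B, x j ^ 2) := by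
  have h1 := sq_sum_le_card_mul_sum_sq (s := A) (f := x)
  have h2 := sq_sum_le_card_mul_sum_sq (s := B) (f := x)
  have hP : 0 ≤ ∑ i ∈ A, x i ^ 2 := Finset.sum_nonneg fun _ _ => sq_nonneg _
  have hQ : 0 ≤ ∑ j ∈ B, x j ^ 2 := Finset.sum_nonneg fun _ _ => sq_nonneg _
  set P := ∑ i ∈ A, x i ^ 2
  set Q := ∑ j ∈ B, x j ^ 2
  refine abs_le_of_sq_le_sq' ?_ (by positivity) |>.2
  rw [mul_pow √_, Real.sq_sqrt (by positivity)]
  calc (2 * ((∑ i ∈ A, x i) * ∑ j ∈ B, x j)) ^ 2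
      = 4 * ((∑ i ∈ A, x i) ^ 2 * (∑ j ∈ B, x j) ^ 2) := by ring
    _ ≤ 4 * ((#A * P) * (#B * Q)) := by gcongr
    _ = (#A * #B) * (4 * (P * Q)) := by ring
    _ ≤ (#A * #B) * (P + Q) ^ 2 := by
        gcongr
        nlinarith [sq_nonneg (P - Q)]

namespace IsPerron

theorem eigen_center (hx : IsPerron G ρ x) (h : IsBipartiteOff G w A B) :
    ρ * x w = ∑ j ∈ G.neighborFinset w ∩ A, x j + ∑ j ∈ G.neighborFinset w ∩ B, x j := by
  rw [hx.eigen, h.sum_neighborFinset_center]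

/-- The key upper bound for the spectral radius of a graph that is bipartite after deleting a
vertex. -/
theorem add_two_mul_missingWeight_le (hx : IsPerron G ρ x) (h : IsBipartiteOff G w A B) :
    ρ + 2 * missingWeight G x A B ≤ √((#A : ℝ) * #B) * (1 - x w ^ 2) + 2 * ρ * x w ^ 2 := by
  have h1 := h.sum_univ (fun i => x i ^ 2)
  rw [hx.unit] at h1
  have h2 := two_mul_sum_mul_sum_le x A B
  have h3 : ∑ i, x i * (ρ * x i) = ρ := by
    calc ∑ i, x i * (ρ * x i) = ρ * ∑ i, x i ^ 2 := by
          rw [Finset.mul_sum]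
          exact Finset.sum_congr rfl fun i _ => by ring
      _ = ρ := by rw [hx.unit, mul_one]
  rw [h.sum_univ] at h3
  -- The edges at w are seen from both ends, once from w and once from the two parts; each view
  -- contributes ρ x_w².
  have hside : ∀ {A B : Finset V}, IsBipartiteOff G w A B → ∑ i ∈ A, x i * (ρ * x i) =
      ∑ i ∈ A, ∑ j ∈ G.neighborFinset i ∩ B, x i * x j +
        x w * ∑ j ∈ G.neighborFinset w ∩ A, x j := by
    intro A B h
    rw [Finset.inter_comm, ← Finset.sum_ite_mem, Finset.mul_sum, ← Finset.sum_add_distrib]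
    refine Finset.sum_congr rfl fun i hi => ?_
    rw [hx.eigen, h.sum_neighborFinset_of_mem _ hi, mul_add, Finset.mul_sum]
    split_ifs <;> ring
  have h4 : ∑ i ∈ B, ∑ j ∈ G.neighborFinset i ∩ A, x i * x j =
      ∑ i ∈ A, ∑ j ∈ G.neighborFinset i ∩ B, x i * x j := by
    rw [Finset.sum_comm' (t' := A) (s' := fun j => G.neighborFinset j ∩ B)
      (by intro i j; simp [G.adj_comm i j]; tauto)]
    exact Finset.sum_congr rfl fun _ _ => Finset.sum_congr rfl fun _ _ => mul_comm _ _
  have h5 : ∑ i ∈ A, ∑ j ∈ G.neighborFinset i ∩ B, x i * x j + missingWeight G x A B =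
      (∑ i ∈ A, x i) * ∑ j ∈ B, x j := by
    rw [missingWeight, ← Finset.sum_add_distrib, Finset.sum_mul_sum]
    refine Finset.sum_congr rfl fun i _ => ?_
    rw [Finset.inter_comm]
    exact Finset.sum_inter_add_sum_sdiff _ _ _
  rw [hside h, hside h.symm, h4] at h3
  have h6 := hx.eigen_center h
  have h7 : x w * (ρ * x w) = x w * ∑ j ∈ G.neighborFinset w ∩ A, x j +
    x w * ∑ j ∈ G.neighborFinset w ∩ B, x j := by rw [h6]; ring
  have h8 : ∑ i ∈ A, x i ^ 2 + ∑ j ∈ B, x j ^ 2 = 1 - x w ^ 2 := by linarith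
  rw [h8] at h2
  nlinarith

theorem missingWeight_nonneg (hx : IsPerron G ρ x) (A B : Finset V) :
    0 ≤ missingWeight G x A B :=
  Finset.sum_nonneg fun i _ => Finset.sum_nonneg fun j _ => mul_nonneg (hx.nonneg i) (hx.nonneg j)

theorem mul_sum_le_missingWeight (hx : IsPerron G ρ x) {i : V} (hi : i ∈ A) :
    x i * ∑ j ∈ B \ G.neighborFinset i, x j ≤ missingWeight G x A B := by
  rw [Finset.mul_sum]
  exact Finset.single_le_sum (f := fun i => ∑ j ∈ B \ G.neighborFinset i, x i * x j)
    (fun i _ => Finset.sum_nonneg fun j _ => mul_nonneg (hx.nonneg i) (hx.nonneg j)) hi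

theorem mul_le_missingWeight (hx : IsPerron G ρ x) {i j : V} (hi : i ∈ A) (hj : j ∈ B)
    (hij : ¬G.Adj i j) : x i * x j ≤ missingWeight G x A B := by
  refine le_trans ?_ (hx.mul_sum_le_missingWeight hi)
  exact mul_le_mul_of_nonneg_left (Finset.single_le_sum (f := x) (fun j _ => hx.nonneg j)
    (by simpa using ⟨hj, hij⟩)) (hx.nonneg i)

theorem sum_le_card_mul (S : Finset V) {M : ℝ} (hM : ∀ i, x i ≤ M) :
    ∑ j ∈ S, x j ≤ #S * M := by
  rw [← nsmul_eq_mul]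
  exact Finset.sum_le_card_nsmul _ _ _ fun i _ => hM i

theorem card_mul_le_sum (S : Finset V) {M : ℝ} (hM : ∀ i ∈ S, M ≤ x i) :
    #S * M ≤ ∑ j ∈ S, x j := by
  rw [← nsmul_eq_mul]
  exact Finset.card_nsmul_le_sum _ _ _ fun i hi => hM i hi

/-- The eigenvector entries of vertices with few missing pairs are comparable to the maximum. -/
theorem le_mul_entry (hx : IsPerron G ρ x) (h : IsBipartiteOff G w A B) {M : ℝ} (hM0 : 0 < M)
    (hM : ∀ i, x i ≤ M) {u : V} (hu : u ∈ A) (hxu : x u = M) (y : V) {K : ℕ}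
    (hA : ∀ i ∈ A, i ≠ y → #(B \ G.neighborFinset i) ≤ K)
    (hB : ∀ i ∈ B, i ≠ y → #(A \ G.neighborFinset i) ≤ K)
    (ha : Fintype.card V ≤ 5 * #A) (hρ1 : (Fintype.card V : ℝ) ≤ 4 * ρ)
    (hρ2 : ρ ≤ Fintype.card V) (hN : 20 * (K + 1) ≤ Fintype.card V) :
    ∀ i, i ≠ w → i ≠ y → M ≤ 16 * x i := by
  have hN' : (20 * (K + 1) : ℝ) ≤ Fintype.card V := by exact_mod_cast hN
  have ha' : (Fintype.card V : ℝ) ≤ 5 * #A := by exact_mod_cast ha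
  set n : ℝ := (Fintype.card V : ℝ)
  have hK0 : (0 : ℝ) ≤ K := Nat.cast_nonneg K
  have hρ0 : 0 < ρ := by linarith
  have hBsum : (ρ - 1) * M ≤ ∑ j ∈ B, x j := by
    have h1 := hx.eigen u
    rw [h.sum_neighborFinset_of_mem _ hu, hxu] at h1
    have h2 : ∑ j ∈ G.neighborFinset u ∩ B, x j ≤ ∑ j ∈ B, x j :=
      Finset.sum_le_sum_of_subset_of_nonneg Finset.inter_subset_right fun i _ _ => hx.nonneg i
    have h3 : (if u ∈ G.neighborFinset w then x w else 0) ≤ M := by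
      split_ifs
      · exact hM w
      · exact hM0.le
    linarith
  -- Vertices of A see almost the same neighbours as the maximal vertex u, so ρ x_i ≥ (ρ - 1 - K)M,
  -- and 1 + K ≤ ρ/2.
  have hAlow : ∀ i ∈ A, i ≠ y → M ≤ 2 * x i := by
    intro i hi hiy
    have h1 := hx.eigen i
    rw [h.sum_neighborFinset_of_mem _ hi, Finset.inter_comm] at h1
    have h2 := Finset.sum_inter_add_sum_sdiff B (G.neighborFinset i) x
    have h3 := sum_le_card_mul (x := x) (B \ G.neighborFinset i) hM
    have h4 : (#(B \ G.neighborFinset i) : ℝ) ≤ K := by exact_mod_cast hA i hi hiy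
    have h5 : (0 : ℝ) ≤ if i ∈ G.neighborFinset w then x w else 0 := by
      split_ifs
      · exact hx.nonneg w
      · exact le_rfl
    have h6 : (#(B \ G.neighborFinset i) : ℝ) * M ≤ K * M := by gcongr
    have h7 : (ρ - 1 - K) * M ≤ ρ * x i := by linarith
    have h8 : ρ / 2 * M ≤ (ρ - 1 - K) * M := by gcongr; linarith
    refine le_of_mul_le_mul_left ?_ hρ0
    linarith
  intro i hiw hiy
  rcases h.cover i with rfl | hi | hi
  · exact absurd rfl hiw
  · linarith [hAlow i hi hiy, hx.nonneg i]
  · have h1 := hx.eigen i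
    rw [h.symm.sum_neighborFinset_of_mem _ hi, Finset.inter_comm] at h1
    have h5 : (0 : ℝ) ≤ if i ∈ G.neighborFinset w then x w else 0 := by
      split_ifs
      · exact hx.nonneg w
      · exact le_rfl
    -- A vertex of B has at least n/5 - K - 1 ≥ n/8 neighbours in A with entry at least M/2, which
    -- yields the factor 16 as ρ ≤ n.
    have h2 : #((A ∩ G.neighborFinset i).erase y) * (M / 2) ≤
        ∑ j ∈ (A ∩ G.neighborFinset i).erase y, x j := by
      refine card_mul_le_sum _ fun j hj => ?_
      rw [Finset.mem_erase, Finset.mem_inter] at hj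
      linarith [hAlow j hj.2.1 hj.1]
    have h3 : ∑ j ∈ (A ∩ G.neighborFinset i).erase y, x j ≤ ∑ j ∈ A ∩ G.neighborFinset i, x j :=
      Finset.sum_le_sum_of_subset_of_nonneg (Finset.erase_subset _ _) fun i _ _ => hx.nonneg i
    have h4 : #A ≤ #((A ∩ G.neighborFinset i).erase y) + K + 1 := by
      have := Finset.card_inter_add_card_sdiff A (G.neighborFinset i)
      have := Finset.pred_card_le_card_erase (s := A ∩ G.neighborFinset i) (a := y)
      have := hB i hi hiy
      omega
    have h4' : (#A : ℝ) ≤ #((A ∩ G.neighborFinset i).erase y) + K + 1 := by exact_mod_cast h4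
    have h6 : n / 8 * (M / 2) ≤ #((A ∩ G.neighborFinset i).erase y) * (M / 2) := by
      gcongr; linarith
    have h7 : ρ / 8 * (M / 2) ≤ n / 8 * (M / 2) := by gcongr
    refine le_of_mul_le_mul_left ?_ hρ0
    linarith

theorem le_mul_entry' (hx : IsPerron G ρ x) (h : IsBipartiteOff G w A B) {M : ℝ} (hM0 : 0 < M)
    (hM : ∀ i, x i ≤ M) {u : V} (hu : u ≠ w) (hxu : x u = M) (y : V) {K : ℕ}
    (hA : ∀ i ∈ A, i ≠ y → #(B \ G.neighborFinset i) ≤ K)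
    (hB : ∀ i ∈ B, i ≠ y → #(A \ G.neighborFinset i) ≤ K)
    (ha : Fintype.card V ≤ 5 * #A) (hb : Fintype.card V ≤ 5 * #B)
    (hρ1 : (Fintype.card V : ℝ) ≤ 4 * ρ)
    (hρ2 : ρ ≤ Fintype.card V) (hN : 20 * (K + 1) ≤ Fintype.card V) :
    ∀ i, i ≠ w → i ≠ y → M ≤ 16 * x i := by
  rcases (h.cover u).resolve_left hu with hu | hu
  · exact hx.le_mul_entry h hM0 hM hu hxu y hA hB ha hρ1 hρ2 hN
  · exact hx.le_mul_entry h.symm hM0 hM hu hxu y hB hA hb hρ1 hρ2 hN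

theorem card_sdiff_le_sum {i : V} (hi : i ∈ A) :
    #(B \ G.neighborFinset i) ≤ ∑ i ∈ A, #(B \ G.neighborFinset i) :=
  Finset.single_le_sum (f := fun i => #(B \ G.neighborFinset i)) (fun _ _ => Nat.zero_le _) hi

theorem card_sdiff_le_sum' {i : V} (hi : i ∈ B) :
    #(A \ G.neighborFinset i) ≤ ∑ i ∈ A, #(B \ G.neighborFinset i) := by
  rw [sum_card_sdiff_neighborFinset_comm]
  exact card_sdiff_le_sum hi

theorem missingWeight_le (hx : IsPerron G ρ x) (h : IsBipartiteOff G w A B)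
    (hsqrt : √((#A : ℝ) * #B) ≤ ρ) :
    2 * missingWeight G x A B ≤ x w ^ 2 * (2 * ρ - √((#A : ℝ) * #B)) := by
  have := hx.add_two_mul_missingWeight_le h
  linarith

/-- If the entry of the centre is small and few pairs are missing away from one vertex, then no
pair is missing at all. -/
theorem adj_of_center_small (hx : IsPerron G ρ x) (h : IsBipartiteOff G w A B) {M : ℝ}
    (hM0 : 0 < M) (hM : ∀ i, x i ≤ M) {u : V} (hu : u ≠ w) (hxu : x u = M) (y : V) {K : ℕ}
    (hA : ∀ i ∈ A, i ≠ y → #(B \ G.neighborFinset i) ≤ K)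
    (hB : ∀ i ∈ B, i ≠ y → #(A \ G.neighborFinset i) ≤ K)
    (hw : ρ * x w ≤ K * M)
    (hμ : ∑ i ∈ A, #(B \ G.neighborFinset i) ≤ K + G.degree w)
    (ha : Fintype.card V ≤ 5 * #A) (hb : Fintype.card V ≤ 5 * #B)
    (hρ1 : (Fintype.card V : ℝ) ≤ 4 * ρ)
    (hρ2 : ρ ≤ Fintype.card V) (hsqrt : √((#A : ℝ) * #B) ≤ ρ)
    (hN : 20 * (17 * K + 2) + 1024 * K ^ 2 + 1 ≤ Fintype.card V) :
    ∀ i ∈ A, ∀ j ∈ B, G.Adj i j := by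
  have hlow := hx.le_mul_entry' h hM0 hM hu hxu y hA hB ha hb hρ1 hρ2 (by nlinarith)
  have hdeg : G.degree w ≤ 16 * K + 1 := by
    have h1 : #((G.neighborFinset w).erase y) * (M / 16) ≤
        ∑ j ∈ (G.neighborFinset w).erase y, x j := by
      refine card_mul_le_sum _ fun j hj => ?_
      rw [Finset.mem_erase, SimpleGraph.mem_neighborFinset] at hj
      linarith [hlow j hj.2.ne' hj.1]
    have h2 : ∑ j ∈ (G.neighborFinset w).erase y, x j ≤ ∑ j ∈ G.neighborFinset w, x j :=
      Finset.sum_le_sum_of_subset_of_nonneg (Finset.erase_subset _ _) fun i _ _ => hx.nonneg i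
    rw [← hx.eigen] at h2
    have h3 : (#((G.neighborFinset w).erase y) : ℝ) ≤ 16 * K := by
      refine le_of_mul_le_mul_right ?_ hM0
      linarith
    have h4 : #((G.neighborFinset w).erase y) ≤ 16 * K := by exact_mod_cast h3
    have h5 := Finset.pred_card_le_card_erase (s := G.neighborFinset w) (a := y)
    rw [G.card_neighborFinset_eq_degree] at h5
    omega
  -- Now that deg w is bounded, the total number of missing pairs is too, so no exceptional vertex
  -- remains and w is only a dummy for y.
  have hlow' := hx.le_mul_entry' h hM0 hM hu hxu w (K := 17 * K + 1)
    (fun i hi _ => (card_sdiff_le_sum hi).trans (by omega))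
    (fun i hi _ => (card_sdiff_le_sum' hi).trans (by omega)) ha hb hρ1 hρ2 (by nlinarith)
  intro i hi j hj
  by_contra hij
  have h1 := hx.mul_le_missingWeight hi hj hij
  have hiw : i ≠ w := fun e => h.notMemA (e ▸ hi)
  have hjw : j ≠ w := fun e => h.notMemB (e ▸ hj)
  have h2 := hlow' i hiw hiw
  have h3 := hlow' j hjw hjw
  have h4 := hx.missingWeight_le h hsqrt
  have hN' : (20 * (17 * K + 2) + 1024 * K ^ 2 + 1 : ℝ) ≤ Fintype.card V := by exact_mod_cast hN
  have hK0 : (0 : ℝ) ≤ K := Nat.cast_nonneg K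
  have hρ0 : 0 < ρ := by nlinarith
  -- A missing pair weighs at least M²/256, but all of them weigh at most ρ x_w² ≤ K²M²/ρ. This
  -- forces ρ ≤ 256K², against n ≤ 4ρ and n > 1024K².
  have h5 : M * M ≤ (16 * x i) * (16 * x j) :=
    mul_le_mul h2 h3 hM0.le (by linarith [hx.nonneg i])
  have h6 : M * M ≤ 256 * (x w ^ 2 * ρ) := by
    have h7 : 0 ≤ x w ^ 2 * √((#A : ℝ) * #B) := by positivity
    nlinarith
  have h8 : (ρ * x w) ^ 2 ≤ (K * M) ^ 2 :=
    pow_le_pow_left₀ (mul_nonneg hρ0.le (hx.nonneg w)) hw 2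
  have h9 : M ^ 2 * ρ ≤ M ^ 2 * (256 * K ^ 2) := by nlinarith
  have h10 : ρ ≤ 256 * K ^ 2 := le_of_mul_le_mul_left h9 (by positivity)
  nlinarith

end IsPerron

end SpectralFinal

/-! ### The two parts are completely joined and balanced. -/

section CompleteParts

variable {V : Type*} [Fintype V] [DecidableEq V] {G : SimpleGraph V} [DecidableRel G.Adj]
  {ρ : ℝ} {x : V → ℝ} {w : V} {A B : Finset V}

namespace IsBipartiteOff

theorem degree_eq (h : IsBipartiteOff G w A B) :
    G.degree w = #(G.neighborFinset w ∩ A) + #(G.neighborFinset w ∩ B) := by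
  have := h.sum_neighborFinset_center (fun _ => 1)
  simpa using this

/-- A part smaller than n/5 would leave at most n²/5 + n edges, short of n²/4 - n/2 - C. -/
theorem card_le_five_mul {C : ℕ} (h : IsBipartiteOff G w A B)
    (hm : (Fintype.card V - 1) / 2 * (Fintype.card V / 2) ≤ #G.edgeFinset + C)
    (hN : 20 * C + 100 ≤ Fintype.card V) :
    Fintype.card V ≤ 5 * #A := by
  have h1 := sq_le_four_mul_half_mul_half (Fintype.card V)
  have h2 := h.card_edgeFinset_add
  have h3 := h.degree_eq
  have h4 := G.degree_lt_card_verts w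
  have h5 := h.card_add_card
  by_contra! hc
  have h6 : 5 * #A * #B ≤ Fintype.card V * Fintype.card V := by
    apply Nat.mul_le_mul <;> omega
  set n := Fintype.card V
  have h7 : 100 * n ≤ n ^ 2 := by rw [sq]; gcongr; omega
  have h8 : #G.edgeFinset ≤ #A * #B + n := by omega
  have h9 : 5 * n ^ 2 ≤ 4 * (5 * #A * #B) + 30 * n + 20 * C := by linarith
  nlinarith

/-- If the only neighbour of the centre `w` in `B` is `y`, the roles of `w` and `y` can be
exchanged. -/
theorem exchange (h : IsBipartiteOff G w A B) {y : V} (hy : G.neighborFinset w ∩ B = {y}) :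
    IsBipartiteOff G y A (insert w (B.erase y)) := by
  have hyB : y ∈ B := (Finset.mem_inter.1 (hy ▸ Finset.mem_singleton_self y)).2
  have hwy : G.Adj w y := (G.mem_neighborFinset w y).1
    (Finset.mem_inter.1 (hy ▸ Finset.mem_singleton_self y)).1
  have hwB : ∀ j ∈ B, G.Adj w j → j = y := fun j hj hwj =>
    Finset.mem_singleton.1 (hy ▸ Finset.mem_inter.2 ⟨(G.mem_neighborFinset w j).2 hwj, hj⟩)
  refine ⟨Finset.disjoint_right.1 h.disj hyB, ?_, ?_, ?_, h.indepA, ?_⟩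
  · simp [hwy.ne']
  · rw [Finset.disjoint_insert_right]
    exact ⟨h.notMemA, Finset.disjoint_of_subset_right (Finset.erase_subset _ _) h.disj⟩
  · intro i
    have := h.cover i
    simp only [Finset.mem_insert, Finset.mem_erase]
    tauto
  · intro u hu v hv huv
    simp only [Finset.mem_insert, Finset.mem_erase] at hu hv
    rcases hu with rfl | ⟨huy, hu⟩ <;> rcases hv with rfl | ⟨hvy, hv⟩
    · exact huv.ne rfl
    · exact hvy (hwB v hv huv)
    · exact huy (hwB u hu huv.symm)
    · exact h.indepB u hu v hv huv

theorem neighborFinset_inter_exchange (h : IsBipartiteOff G w A B) {y : V}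
    (hy : G.neighborFinset w ∩ B = {y}) :
    G.neighborFinset y ∩ insert w (B.erase y) = {w} := by
  have hyB : y ∈ B := (Finset.mem_inter.1 (hy ▸ Finset.mem_singleton_self y)).2
  have hwy : G.Adj w y := (G.mem_neighborFinset w y).1
    (Finset.mem_inter.1 (hy ▸ Finset.mem_singleton_self y)).1
  ext j
  simp only [Finset.mem_inter, SimpleGraph.mem_neighborFinset, Finset.mem_insert,
    Finset.mem_erase, Finset.mem_singleton]
  constructor
  · rintro ⟨hj, rfl | hj'⟩
    · rfl
    · exact absurd hj (h.indepB y hyB j hj'.2)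
  · rintro rfl
    exact ⟨hwy.symm, Or.inl rfl⟩

end IsBipartiteOff

namespace IsPerron

theorem le_card (hx : IsPerron G ρ x) : ρ ≤ Fintype.card V := by
  obtain ⟨u, hu, hmax⟩ := hx.exists_max
  refine (hx.le_degree hu hmax).trans ?_
  exact_mod_cast (G.degree_lt_card_verts u).le

end IsPerron

theorem card_le_four_mul {n : ℕ} {ρ : ℝ} (hρ0 : 0 ≤ ρ)
    (hq : (((n - 1) / 2 * (n / 2) : ℕ) : ℝ) ≤ ρ ^ 2) (hn : 4 ≤ n) : (n : ℝ) ≤ 4 * ρ := by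
  have h1 : ((n ^ 2 : ℕ) : ℝ) ≤ ((4 * ((n - 1) / 2 * (n / 2)) + 2 * n : ℕ) : ℝ) := by
    exact_mod_cast sq_le_four_mul_half_mul_half n
  have hn' : (4 : ℝ) ≤ n := by exact_mod_cast hn
  rw [Nat.cast_add, Nat.cast_mul 4, Nat.cast_pow, Nat.cast_mul 2] at h1
  push_cast at h1 hq
  nlinarith

namespace IsPerron

theorem sqrt_mul_le (h : IsBipartiteOff G w A B) (hρ0 : 0 ≤ ρ)
    (hq : (((Fintype.card V - 1) / 2 * (Fintype.card V / 2) : ℕ) : ℝ) ≤ ρ ^ 2) :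
    √((#A : ℝ) * #B) ≤ ρ := by
  rw [Real.sqrt_le_left hρ0]
  refine le_trans ?_ hq
  exact_mod_cast mul_le_half_mul_half h.card_add_card

/-- From ts ≤ μ + tr and μ ≤ C + s + t follows (t - 1)s ≤ C + t(r + 1), so t ≥ 2 bounds s and hence
deg w; the centre then has a small entry. -/
theorem adj_of_two_le (hx : IsPerron G ρ x) (h : IsBipartiteOff G w A B) {r C K : ℕ}
    (hG : G.CodegreeLE r) (hρ0 : 0 ≤ ρ)
    (hq : (((Fintype.card V - 1) / 2 * (Fintype.card V / 2) : ℕ) : ℝ) ≤ ρ ^ 2)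
    (hm : (Fintype.card V - 1) / 2 * (Fintype.card V / 2) ≤ #G.edgeFinset + C)
    (ht : 2 ≤ #(G.neighborFinset w ∩ B))
    (hts : #(G.neighborFinset w ∩ B) ≤ #(G.neighborFinset w ∩ A))
    (hK : 10 * (C + r + 1) = K)
    (hN : 20 * (17 * K + 2) + 1024 * K ^ 2 + 1 ≤ Fintype.card V) :
    ∀ i ∈ A, ∀ j ∈ B, G.Adj i j := by
  have h1 := h.card_edgeFinset_add
  have h2 := IsBipartiteOff.mul_le_missing (w := w) (A := A) (B := B) hG
  have h3 := mul_le_half_mul_half h.card_add_card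
  have h4 := h.degree_eq
  have hn : 20 * (17 * K + 2) ≤ Fintype.card V := by omega
  have hρ1 := card_le_four_mul hρ0 hq (by omega)
  obtain ⟨u, hu, hmax⟩ := hx.exists_max
  have hs : #(G.neighborFinset w ∩ A) ≤ C + 2 * (r + 1) := by
    set s := #(G.neighborFinset w ∩ A)
    set t := #(G.neighborFinset w ∩ B)
    obtain ⟨c, hc⟩ := Nat.exists_eq_add_of_le' ht
    by_contra! hcon
    have h5 : t * s ≤ C + s + t + t * r := by omega
    rw [hc] at h5
    nlinarith
  have hw : ρ * x w ≤ K * x u := by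
    rw [hx.eigen]
    refine (sum_le_card_mul _ hmax).trans ?_
    rw [G.card_neighborFinset_eq_degree]
    gcongr
    omega
  have huw : u ≠ w := by
    rintro rfl
    have h5 := hx.le_degree hu hmax
    have h6 : Fintype.card V ≤ 4 * G.degree u := by
      have : (Fintype.card V : ℝ) ≤ 4 * G.degree u := by linarith
      exact_mod_cast this
    omega
  refine hx.adj_of_center_small h hu hmax huw rfl w (K := K)
    (fun i hi _ => (card_sdiff_le_sum hi).trans (by omega))
    (fun i hi _ => (card_sdiff_le_sum' hi).trans (by omega)) hw (by omega)
    (h.card_le_five_mul hm (by omega)) (h.symm.card_le_five_mul hm (by omega)) hρ1 hx.le_card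
    (sqrt_mul_le h hρ0 hq) hN

/-- Needed to lower the factor 2ρ - √(|A||B|) to 3ρ/2; with 2ρ the estimate in `adj_of_eq_singleton`
would not close. -/
theorem half_le_sqrt (hx : IsPerron G ρ x) (h : IsBipartiteOff G w A B) {r : ℕ}
    (hG : G.CodegreeLE r)
    (ha : Fintype.card V ≤ 5 * #A) (hb : Fintype.card V ≤ 5 * #B)
    (hN : 20 * (r + 1) ≤ Fintype.card V) : ρ ≤ 2 * √((#A : ℝ) * #B) := by
  have h1 := hx.two_mul_sq_le_of_codegreeLE hG
  have h2 := h.card_edgeFinset_add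
  have h3 := h.degree_eq
  have h4 := G.degree_lt_card_verts w
  have h5 : Fintype.card V * Fintype.card V ≤ 5 * #A * (5 * #B) := Nat.mul_le_mul ha hb
  have h6 : 2 * #G.edgeFinset + r * Fintype.card V ≤ 8 * (#A * #B) := by
    have h7 : #G.edgeFinset ≤ #A * #B + Fintype.card V := by omega
    nlinarith
  have h6' : (2 * #G.edgeFinset + r * Fintype.card V : ℝ) ≤ 8 * (#A * #B) := by exact_mod_cast h6
  refine abs_le_of_sq_le_sq' ?_ (by positivity) |>.2
  rw [mul_pow, Real.sq_sqrt (by positivity)]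
  linarith

/-- Here w may have many neighbours in A, but y misses all except r of them. Since x_w ≤ x_y, the
weight of these missing pairs bounds the entries around w, so ρ x_w is still O(1) times the maximum.
-/
theorem adj_of_eq_singleton (hx : IsPerron G ρ x) (h : IsBipartiteOff G w A B) {r C K : ℕ}
    (hG : G.CodegreeLE r) (hρ0 : 0 ≤ ρ)
    (hq : (((Fintype.card V - 1) / 2 * (Fintype.card V / 2) : ℕ) : ℝ) ≤ ρ ^ 2)
    (hm : (Fintype.card V - 1) / 2 * (Fintype.card V / 2) ≤ #G.edgeFinset + C)
    {y : V} (hy : G.neighborFinset w ∩ B = {y}) (hxy : x w ≤ x y)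
    (hK : 10 * (C + r + 1) = K)
    (hN : 20 * (17 * K + 2) + 1024 * K ^ 2 + 1 ≤ Fintype.card V) :
    ∀ i ∈ A, ∀ j ∈ B, G.Adj i j := by
  have hyB : y ∈ B := (Finset.mem_inter.1 (hy ▸ Finset.mem_singleton_self y)).2
  have hwy : G.Adj w y := (G.mem_neighborFinset w y).1
    (Finset.mem_inter.1 (hy ▸ Finset.mem_singleton_self y)).1
  have h1 := h.card_edgeFinset_add
  have h3 := mul_le_half_mul_half h.card_add_card
  have h4 := h.degree_eq
  rw [hy, Finset.card_singleton] at h1 h4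
  have hn : 20 * (17 * K + 2) ≤ Fintype.card V := by omega
  have hρ1 := card_le_four_mul hρ0 hq (by omega)
  have ha := h.card_le_five_mul hm (by omega)
  have hb := h.symm.card_le_five_mul hm (by omega)
  have hsqrt := sqrt_mul_le h hρ0 hq
  obtain ⟨u, huw, hu, hmax⟩ : ∃ u, u ≠ w ∧ 0 < x u ∧ ∀ i, x i ≤ x u := by
    obtain ⟨u, hu, hmax⟩ := hx.exists_max
    by_cases huw : u = w
    · subst huw
      exact ⟨y, hwy.ne', by linarith, fun i => (hmax i).trans hxy⟩
    · exact ⟨u, huw, hu, hmax⟩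
  have hmissy : #(G.neighborFinset w ∩ A) ≤ #(A \ G.neighborFinset y) + r := by
    have h5 := hG w y hwy
    have h6 : G.neighborFinset w ∩ A ⊆
        (A \ G.neighborFinset y) ∪ (G.neighborFinset w ∩ G.neighborFinset y) := by
      intro z hz
      simp only [Finset.mem_union, Finset.mem_inter, Finset.mem_sdiff] at hz ⊢
      tauto
    have h7 := (Finset.card_le_card h6).trans (Finset.card_union_le _ _)
    omega
  -- In total at most C + s + 1 pairs are missing, and y accounts for at least s - r of them.
  have hμ : ∑ j ∈ B.erase y, #(A \ G.neighborFinset j) ≤ C + r + 1 := by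
    have h5 := Finset.add_sum_erase B (fun j => #(A \ G.neighborFinset j)) hyB
    rw [sum_card_sdiff_neighborFinset_comm] at h1
    omega
  have hBmiss : ∀ i ∈ B, i ≠ y → #(A \ G.neighborFinset i) ≤ K := fun i hi hiy => by
    have := Finset.single_le_sum (f := fun j => #(A \ G.neighborFinset j))
      (fun _ _ => Nat.zero_le _) (Finset.mem_erase.2 ⟨hiy, hi⟩)
    omega
  have hAmiss : ∀ i ∈ A, i ≠ y → #(B \ G.neighborFinset i) ≤ K := fun i hi _ => by
    rw [← sum_card_sdiff_neighborFinset_comm] at hμ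
    have h5 := (card_sdiff_le_sum (B := B.erase y) hi).trans hμ
    have h6 : #(B \ G.neighborFinset i) ≤ #(B.erase y \ G.neighborFinset i) + 1 := by
      rw [Finset.erase_sdiff_comm]
      have := Finset.pred_card_le_card_erase (s := B \ G.neighborFinset i) (a := y)
      omega
    omega
  refine hx.adj_of_center_small h hu hmax huw rfl y hAmiss hBmiss ?_ (by omega) ha hb hρ1
    hx.le_card hsqrt hN
  have h5 := hx.eigen_center h
  rw [hy, Finset.sum_singleton] at h5
  have h6 := hx.missingWeight_le h hsqrt
  rw [missingWeight_comm] at h6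
  have h7 := hx.mul_sum_le_missingWeight (B := A) hyB
  have h8 : ∑ j ∈ G.neighborFinset w ∩ A, x j ≤
      ∑ j ∈ A \ G.neighborFinset y, x j + r * x u := by
    rw [← Finset.sum_inter_add_sum_sdiff _ (G.neighborFinset y), add_comm]
    refine add_le_add (Finset.sum_le_sum_of_subset_of_nonneg
      (Finset.sdiff_subset_sdiff Finset.inter_subset_right (Finset.Subset.refl _))
      fun i _ _ => hx.nonneg i) ?_
    refine (sum_le_card_mul _ hmax).trans ?_
    gcongr
    refine (Finset.card_le_card fun j hj => ?_).trans (hG w y hwy)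
    simp only [Finset.mem_inter] at hj ⊢
    tauto
  have h9 := hx.half_le_sqrt h hG ha hb (by omega)
  set S := ∑ j ∈ G.neighborFinset w ∩ A, x j
  set D := ∑ j ∈ A \ G.neighborFinset y, x j
  have hw0 := hx.nonneg w
  have hy1 := hmax y
  have hK' : (4 * r + 4 : ℝ) ≤ K := by
    have : 4 * r + 4 ≤ K := by omega
    exact_mod_cast this
  have hr0 : (0 : ℝ) ≤ r := Nat.cast_nonneg r
  have hru : 0 ≤ r * x u := mul_nonneg hr0 hu.le
  have h10 : (4 * r + 4 : ℝ) * x u ≤ K * x u := by gcongr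
  rw [h5]
  rcases hw0.eq_or_lt with h0 | h0
  · rw [← h5, ← h0]
    simp only [mul_zero]
    positivity
  -- Cancelling x_w gives 2D ≤ (3/2)(S + x_y). With S ≤ D + r x_u this yields S + x_y ≤ (4r + 4)
  -- x_u.
  · have hD : 0 ≤ D := Finset.sum_nonneg fun i _ => hx.nonneg i
    have h11 : x w * D ≤ x y * D := by gcongr
    have h12 : x w ^ 2 * (2 * ρ - √((#A : ℝ) * #B)) ≤ x w ^ 2 * (3 / 2 * ρ) := by
      gcongr; linarith
    have h13 : x w ^ 2 * (3 / 2 * ρ) = x w * (3 / 2 * (S + x y)) := by rw [← h5]; ring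
    have h14 : x w * (2 * D) ≤ x w * (3 / 2 * (S + x y)) := by linarith
    have h15 := le_of_mul_le_mul_left h14 h0
    linarith

/-- In a non-bipartite graph with large spectral radius that is bipartite after deleting one
vertex, that vertex can be chosen such that the remaining bipartite graph is complete. -/
theorem exists_complete (hx : IsPerron G ρ x) (h : IsBipartiteOff G w A B) {r C K : ℕ}
    (hG : G.CodegreeLE r) (hnb : ¬G.IsBipartite) (hρ0 : 0 ≤ ρ)
    (hq : (((Fintype.card V - 1) / 2 * (Fintype.card V / 2) : ℕ) : ℝ) ≤ ρ ^ 2)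
    (hm : (Fintype.card V - 1) / 2 * (Fintype.card V / 2) ≤ #G.edgeFinset + C)
    (hK : 10 * (C + r + 1) = K)
    (hN : 20 * (17 * K + 2) + 1024 * K ^ 2 + 1 ≤ Fintype.card V) :
    ∃ w A B, IsBipartiteOff G w A B ∧ ∀ i ∈ A, ∀ j ∈ B, G.Adj i j := by
  wlog hts : #(G.neighborFinset w ∩ B) ≤ #(G.neighborFinset w ∩ A) generalizing A B
  · exact this h.symm (le_of_not_ge hts)
  have ht := h.symm.one_le_card_inter hnb
  rcases ht.eq_or_lt with ht | ht
  · obtain ⟨y, hy⟩ := Finset.card_eq_one.1 ht.symm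
    rcases le_total (x w) (x y) with hxy | hxy
    · exact ⟨w, A, B, h, hx.adj_of_eq_singleton h hG hρ0 hq hm hy hxy hK hN⟩
    · exact ⟨y, A, _, h.exchange hy, hx.adj_of_eq_singleton (h.exchange hy) hG hρ0 hq hm
        (h.neighborFinset_inter_exchange hy) hxy hK hN⟩
  · exact ⟨w, A, B, h, hx.adj_of_two_le h hG hρ0 hq hm ht hts hK hN⟩

/-- If |A||B| ≤ q - 1, then ρ² exceeds |A||B| by at least 1, so ρ - √(|A||B|) ≥ 1/(2ρ). But this gap
is at most 2ρ x_w², and ρ x_w ≤ 2r x_u tends to 0. -/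
theorem mul_eq_half_mul_half (hx : IsPerron G ρ x) (h : IsBipartiteOff G w A B) {r : ℕ}
    (hρ0 : 0 ≤ ρ)
    (hq : (((Fintype.card V - 1) / 2 * (Fintype.card V / 2) : ℕ) : ℝ) ≤ ρ ^ 2)
    (hdeg : G.degree w ≤ 2 * r) (hN : 1024 * r ^ 2 + 4 ≤ Fintype.card V) :
    #A * #B = (Fintype.card V - 1) / 2 * (Fintype.card V / 2) := by
  by_contra hne
  have h1 : #A * #B + 1 ≤ (Fintype.card V - 1) / 2 * (Fintype.card V / 2) :=
    lt_of_le_of_ne (mul_le_half_mul_half h.card_add_card) hne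
  have h2 : (#A * #B + 1 : ℝ) ≤ ρ ^ 2 := le_trans (by exact_mod_cast h1) hq
  have hρ1 := card_le_four_mul hρ0 hq (by omega)
  have hρ2 := hx.le_card
  have hsqrt := sqrt_mul_le h hρ0 hq
  have h3 := hx.missingWeight_le h hsqrt
  have h4 := hx.add_two_mul_missingWeight_le h
  have h5 := hx.missingWeight_nonneg A B
  obtain ⟨u, hu, hmax⟩ := hx.exists_max
  have h6 : ρ * x w ≤ 2 * r * x u := by
    rw [hx.eigen]
    refine (sum_le_card_mul _ hmax).trans ?_
    rw [G.card_neighborFinset_eq_degree]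
    gcongr
    exact_mod_cast hdeg
  -- Cauchy–Schwarz and the unit norm give x_u² ≤ n/ρ² ≤ 16/n.
  have h7 : (ρ * x u) ^ 2 ≤ Fintype.card V := by
    rw [hx.eigen]
    refine sq_sum_le_card_mul_sum_sq.trans ?_
    have h8 : ∑ i ∈ G.neighborFinset u, x i ^ 2 ≤ 1 := by
      rw [← hx.unit]
      exact Finset.sum_le_sum_of_subset_of_nonneg (Finset.subset_univ _) fun i _ _ => sq_nonneg _
    have h9 : (#(G.neighborFinset u) : ℝ) ≤ Fintype.card V := by
      exact_mod_cast Finset.card_le_univ _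
    calc (#(G.neighborFinset u) : ℝ) * ∑ i ∈ G.neighborFinset u, x i ^ 2
        ≤ Fintype.card V * 1 := by gcongr
      _ = _ := mul_one _
  have hN' : (1024 * r ^ 2 + 4 : ℝ) ≤ Fintype.card V := by exact_mod_cast hN
  have h8 : √((#A : ℝ) * #B) ^ 2 = #A * #B := Real.sq_sqrt (by positivity)
  have hs0 : 0 ≤ √((#A : ℝ) * #B) := Real.sqrt_nonneg _
  set n : ℝ := (Fintype.card V : ℝ)
  set σ := √((#A : ℝ) * #B)
  have hn4 : (4 : ℝ) ≤ n := by nlinarith [sq_nonneg (r : ℝ)]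
  have hρpos : 0 < ρ := by linarith
  have h9 : ρ - σ ≤ 2 * (ρ * x w ^ 2) := by nlinarith [mul_nonneg hs0 (sq_nonneg (x w))]
  have h10 : 1 ≤ (ρ - σ) * (2 * ρ) := by nlinarith
  have h11 : 1 ≤ 4 * (ρ * x w) ^ 2 := by nlinarith
  have h12 : (ρ * x w) ^ 2 ≤ (2 * r * x u) ^ 2 :=
    pow_le_pow_left₀ (mul_nonneg hρ0 (hx.nonneg w)) h6 2
  have h13 : 1 ≤ 16 * r ^ 2 * x u ^ 2 := by nlinarith
  have h14 : ρ ^ 2 ≤ 16 * r ^ 2 * n := by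
    calc ρ ^ 2 = ρ ^ 2 * 1 := by ring
      _ ≤ ρ ^ 2 * (16 * r ^ 2 * x u ^ 2) := by gcongr
      _ = 16 * r ^ 2 * (ρ * x u) ^ 2 := by ring
      _ ≤ _ := by gcongr
  have h15 : n ^ 2 ≤ 256 * r ^ 2 * n := by nlinarith
  nlinarith

end IsPerron

end CompleteParts

/-! ### Comparison graph, edge additions and the size of spectral extremal graphs. -/

section Extremal

variable {V : Type*} [Fintype V] [DecidableEq V] {G : SimpleGraph V} [DecidableRel G.Adj]
  {ρ : ℝ} {x : V → ℝ} {w : V} {A B : Finset V}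

theorem not_isBipartite_of_triangle {a b c : V} (hab : G.Adj a b) (hbc : G.Adj b c)
    (hac : G.Adj a c) : ¬G.IsBipartite := by
  rintro ⟨f⟩
  have h1 := f.valid hab
  have h2 := f.valid hbc
  have h3 := f.valid hac
  omega

namespace IsBipartiteOff

/-- An A–B edge can have only w as a common neighbour, and an edge from w into one part has its
common neighbours among those of w in the other. -/
theorem codegreeLE (h : IsBipartiteOff G w A B) {r : ℕ} (hr : 1 ≤ r)
    (hA : #(G.neighborFinset w ∩ A) ≤ r) (hB : #(G.neighborFinset w ∩ B) ≤ r) :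
    G.CodegreeLE r := by
  have hw : ∀ {A B : Finset V}, IsBipartiteOff G w A B → #(G.neighborFinset w ∩ B) ≤ r →
      ∀ v ∈ A, #(G.neighborFinset w ∩ G.neighborFinset v) ≤ r := by
    intro A B h hB v hv
    refine (Finset.card_le_card fun z hz => ?_).trans hB
    have h1 := h.cover z
    have h2 := h.indepA v hv z
    simp only [Finset.mem_inter, SimpleGraph.mem_neighborFinset] at hz ⊢
    have h3 := hz.1.ne'
    tauto
  have hAB : ∀ {A B : Finset V}, IsBipartiteOff G w A B → ∀ u ∈ A, ∀ v ∈ B,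
      #(G.neighborFinset u ∩ G.neighborFinset v) ≤ r := by
    intro A B h u hu v hv
    refine (Finset.card_le_card fun z hz => ?_).trans ((Finset.card_singleton w).le.trans hr)
    have h1 := h.cover z
    have h2 := h.indepA u hu z
    have h3 := h.indepB v hv z
    simp only [Finset.mem_inter, SimpleGraph.mem_neighborFinset, Finset.mem_singleton] at hz ⊢
    tauto
  intro u v huv
  rcases h.cover u with rfl | hu | hu <;> rcases h.cover v with rfl | hv | hv
  · exact absurd huv G.irrefl
  · exact hw h hB v hv
  · exact hw h.symm hA v hv
  · rw [Finset.inter_comm]; exact hw h hB u hu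
  · exact absurd huv (h.indepA u hu v hv)
  · exact hAB h u hu v hv
  · rw [Finset.inter_comm]; exact hw h.symm hA u hu
  · exact hAB h.symm u hu v hv
  · exact absurd huv (h.indepB u hu v hv)

/-- The test vector is the leading eigenvector of the complete bipartite graph, extended by 0 at w.
-/
theorem sqrt_le_graphSpectralRadius (h : IsBipartiteOff G w A B)
    (hc : ∀ i ∈ A, ∀ j ∈ B, G.Adj i j) (hA : A.Nonempty) (hB : B.Nonempty) :
    √((#A : ℝ) * #B) ≤ graphSpectralRadius G := by
  have hne : Nonempty V := ⟨w⟩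
  set a : ℝ := (#A : ℝ)
  set b : ℝ := (#B : ℝ)
  have ha : 0 < a := Nat.cast_pos.2 hA.card_pos
  have hb : 0 < b := Nat.cast_pos.2 hB.card_pos
  let y : V → ℝ := fun i => if i ∈ A then √b else if i ∈ B then √a else 0
  have hyA : ∀ i ∈ A, y i = √b := fun i hi => by simp [y, hi]
  have hyB : ∀ i ∈ B, y i = √a := fun i hi => by
    simp [y, hi, Finset.disjoint_right.1 h.disj hi]
  have hyw : y w = 0 := by simp [y, h.notMemA, h.notMemB]
  have hside : ∀ {A B : Finset V} {p q : ℝ}, IsBipartiteOff G w A B →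
      (∀ i ∈ A, ∀ j ∈ B, G.Adj i j) → (∀ i ∈ A, y i = p) → (∀ i ∈ B, y i = q) →
      ∑ i ∈ A, y i * ∑ j ∈ G.neighborFinset i, y j = #A * (p * (#B * q)) := by
    intro A B p q h hc hp hq
    rw [← nsmul_eq_mul #A]
    refine Finset.sum_eq_card_nsmul fun i hi => ?_
    have hB : G.neighborFinset i ∩ B = B :=
      Finset.inter_eq_right.2 fun j hj => (G.mem_neighborFinset i j).2 (hc i hi j hj)
    rw [h.sum_neighborFinset_of_mem _ hi, hB, hyw, ite_self, add_zero, hp i hi,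
      Finset.sum_eq_card_nsmul hq, nsmul_eq_mul]
  have h1 := rayleigh_le_graphSpectralRadius G y
  have h2 : ∑ i ∈ A, y i ^ 2 = a * b := by
    rw [← nsmul_eq_mul]
    exact Finset.sum_eq_card_nsmul fun i hi => by rw [hyA i hi, Real.sq_sqrt hb.le]
  have h3 : ∑ i ∈ B, y i ^ 2 = b * a := by
    rw [← nsmul_eq_mul]
    exact Finset.sum_eq_card_nsmul fun i hi => by rw [hyB i hi, Real.sq_sqrt ha.le]
  rw [h.sum_univ, h.sum_univ, h2, h3, hside h hc hyA hyB,
    hside h.symm (fun i hi j hj => (hc j hj i hi).symm) hyB hyA, hyw] at h1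
  rw [Real.sqrt_mul ha.le]
  refine le_of_mul_le_mul_left ?_ (mul_pos ha hb)
  linarith

end IsBipartiteOff

/-- There are non-bipartite graphs with few triangles on each edge whose spectral radius is at
least that of a balanced complete bipartite graph on all but one of the vertices. -/
theorem exists_le_graphSpectralRadius_sq {r : ℕ} (hr : 1 ≤ r) (hV : 3 ≤ Fintype.card V) :
    ∃ G : SimpleGraph V, ¬G.IsBipartite ∧ (bookGraph (r + 1)).Free G ∧
      0 ≤ graphSpectralRadius G ∧
      (((Fintype.card V - 1) / 2 * (Fintype.card V / 2) : ℕ) : ℝ) ≤ graphSpectralRadius G ^ 2 := by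
  classical
  have hne : Nonempty V := Fintype.card_pos_iff.1 (by omega)
  let w : V := Classical.arbitrary V
  have hcard : #(Finset.univ.erase w) = Fintype.card V - 1 := by
    rw [Finset.card_erase_of_mem (Finset.mem_univ _), Finset.card_univ]
  obtain ⟨A, hA, hAc⟩ := Finset.exists_subset_card_eq
    (s := Finset.univ.erase w) (n := (Fintype.card V - 1) / 2) (by omega)
  set B := Finset.univ.erase w \ A with hB
  have hBc : #B = Fintype.card V / 2 := by
    rw [hB, Finset.card_sdiff_of_subset hA, hcard, hAc]; omega
  have hAn : A.Nonempty := Finset.card_pos.1 (by omega)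
  have hBn : B.Nonempty := Finset.card_pos.1 (by omega)
  obtain ⟨a, ha⟩ := hAn
  obtain ⟨b, hb⟩ := hBn
  have hdisj : Disjoint A B := Finset.disjoint_sdiff
  have hwA : w ∉ A := fun h => by simpa using hA h
  have hwB : w ∉ B := by simp [hB]
  have hcov : ∀ i, i = w ∨ i ∈ A ∨ i ∈ B := fun i => by
    simp only [hB, Finset.mem_sdiff, Finset.mem_erase, Finset.mem_univ, and_true]; tauto
  -- Joining w to one vertex of each part suffices: the resulting triangle destroys bipartiteness.
  let G : SimpleGraph V := SimpleGraph.fromRel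
    (fun i j => (i ∈ A ∧ j ∈ B) ∨ (i = w ∧ (j = a ∨ j = b)))
  have hadj : ∀ i j, G.Adj i j ↔ i ≠ j ∧ (((i ∈ A ∧ j ∈ B) ∨ (i = w ∧ (j = a ∨ j = b))) ∨
      ((j ∈ A ∧ i ∈ B) ∨ (j = w ∧ (i = a ∨ i = b)))) := fun i j => SimpleGraph.fromRel_adj _ _ _
  have haw : a ≠ w := fun h => hwA (h ▸ ha)
  have hbw : b ≠ w := fun h => hwB (h ▸ hb)
  have hbA : b ∉ A := Finset.disjoint_right.1 hdisj hb
  have haB : a ∉ B := Finset.disjoint_left.1 hdisj ha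
  have h : IsBipartiteOff G w A B := by
    refine ⟨hwA, hwB, hdisj, hcov, ?_, ?_⟩
    · intro u hu v hv huv
      rw [hadj] at huv
      have h1 := Finset.disjoint_left.1 hdisj hu
      have h2 := Finset.disjoint_left.1 hdisj hv
      have h3 : u ≠ w := fun h => hwA (h ▸ hu)
      have h4 : v ≠ w := fun h => hwA (h ▸ hv)
      tauto
    · intro u hu v hv huv
      rw [hadj] at huv
      have h1 := Finset.disjoint_right.1 hdisj hu
      have h2 := Finset.disjoint_right.1 hdisj hv
      have h3 : u ≠ w := fun h => hwB (h ▸ hu)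
      have h4 : v ≠ w := fun h => hwB (h ▸ hv)
      tauto
  have hc : ∀ i ∈ A, ∀ j ∈ B, G.Adj i j := fun i hi j hj => by
    rw [hadj]
    exact ⟨fun e => Finset.disjoint_left.1 hdisj hi (e ▸ hj), Or.inl (Or.inl ⟨hi, hj⟩)⟩
  have hwN : ∀ j, G.Adj w j → j = a ∨ j = b := fun j hj => by
    rw [hadj] at hj
    tauto
  have hsA : #(G.neighborFinset w ∩ A) ≤ r := by
    refine (Finset.card_le_card (t := {a}) fun j hj => ?_).trans
      ((Finset.card_singleton a).le.trans hr)
    rw [Finset.mem_inter, SimpleGraph.mem_neighborFinset] at hj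
    rcases hwN j hj.1 with rfl | rfl
    · simp
    · exact absurd hj.2 hbA
  have hsB : #(G.neighborFinset w ∩ B) ≤ r := by
    refine (Finset.card_le_card (t := {b}) fun j hj => ?_).trans
      ((Finset.card_singleton b).le.trans hr)
    rw [Finset.mem_inter, SimpleGraph.mem_neighborFinset] at hj
    rcases hwN j hj.1 with rfl | rfl
    · exact absurd hj.2 haB
    · simp
  have hsqrt := h.sqrt_le_graphSpectralRadius hc ⟨a, ha⟩ ⟨b, hb⟩
  refine ⟨G, not_isBipartite_of_triangle (a := w) (b := a) (c := b) ?_ (hc a ha b hb) ?_,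
    (free_bookGraph_iff r).2 (h.codegreeLE hr hsA hsB), (Real.sqrt_nonneg _).trans hsqrt, ?_⟩
  · rw [hadj]; exact ⟨haw.symm, Or.inl (Or.inr ⟨rfl, Or.inl rfl⟩)⟩
  · rw [hadj]; exact ⟨hbw.symm, Or.inl (Or.inr ⟨rfl, Or.inr rfl⟩)⟩
  · rw [← hAc, ← hBc, Nat.cast_mul]
    exact (Real.sqrt_le_left ((Real.sqrt_nonneg _).trans hsqrt)).1 hsqrt

theorem IsPerron.pos_of_adj (hx : IsPerron G ρ x) (hρ : 0 < ρ) {u v : V} (huv : G.Adj u v)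
    (hu : 0 < x u) : 0 < x v := by
  have h1 : x u ≤ ρ * x v := by
    rw [hx.eigen]
    exact Finset.single_le_sum (f := x) (fun i _ => hx.nonneg i)
      ((G.mem_neighborFinset v u).2 huv.symm)
  exact pos_of_mul_pos_right (hu.trans_le h1) hρ.le

/-- Positivity spreads along edges, and the complete join together with the neighbours of w makes
the graph connected. -/
theorem IsPerron.pos_of_complete (hx : IsPerron G ρ x) (hρ : 0 < ρ)
    (h : IsBipartiteOff G w A B) (hc : ∀ i ∈ A, ∀ j ∈ B, G.Adj i j) (hnb : ¬G.IsBipartite) :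
    ∀ i, 0 < x i := by
  obtain ⟨a, ha⟩ := Finset.card_pos.1 (h.one_le_card_inter hnb)
  obtain ⟨b, hb⟩ := Finset.card_pos.1 (h.symm.one_le_card_inter hnb)
  rw [Finset.mem_inter, SimpleGraph.mem_neighborFinset] at ha hb
  obtain ⟨u, hu, -⟩ := hx.exists_max
  have ha0 : 0 < x a := by
    rcases h.cover u with rfl | hu' | hu'
    · exact hx.pos_of_adj hρ ha.1 hu
    · exact hx.pos_of_adj hρ (hc a ha.2 b hb.2).symm (hx.pos_of_adj hρ (hc u hu' b hb.2) hu)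
    · exact hx.pos_of_adj hρ (hc a ha.2 u hu').symm hu
  have hB0 : ∀ j ∈ B, 0 < x j := fun j hj => hx.pos_of_adj hρ (hc a ha.2 j hj) ha0
  intro i
  rcases h.cover i with rfl | hi | hi
  · exact hx.pos_of_adj hρ ha.1.symm ha0
  · exact hx.pos_of_adj hρ (hc i hi b hb.2).symm (hB0 b hb.2)
  · exact hB0 i hi

/-- Adding an edge strictly increases the spectral radius if the eigenvector is positive. -/
theorem graphSpectralRadius_lt_of_edge (hx : IsPerron G (graphSpectralRadius G) x)
    (hpos : ∀ i, 0 < x i) {u v : V} (huv : u ≠ v) (hnadj : ¬G.Adj u v) :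
    graphSpectralRadius G < graphSpectralRadius (G ⊔ SimpleGraph.edge u v) := by
  classical
  have hne : Nonempty V := ⟨u⟩
  have h1 := rayleigh_le_graphSpectralRadius (G ⊔ SimpleGraph.edge u v) x
  rw [hx.unit, mul_one] at h1
  refine lt_of_lt_of_le ?_ h1
  have h2 : graphSpectralRadius G = ∑ i, x i * ∑ j ∈ G.neighborFinset i, x j := by
    calc graphSpectralRadius G = graphSpectralRadius G * ∑ i, x i ^ 2 := by
          rw [hx.unit, mul_one]
      _ = _ := by
          rw [Finset.mul_sum]
          exact Finset.sum_congr rfl fun i _ => by rw [← hx.eigen]; ring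
  rw [h2]
  have hsub : ∀ i, G.neighborFinset i ⊆ (G ⊔ SimpleGraph.edge u v).neighborFinset i := by
    intro i j hj
    rw [SimpleGraph.mem_neighborFinset] at hj ⊢
    exact Or.inl hj
  refine Finset.sum_lt_sum (fun i _ => mul_le_mul_of_nonneg_left
    (Finset.sum_le_sum_of_subset_of_nonneg (hsub i) fun j _ _ => (hpos j).le) (hpos i).le)
    ⟨u, Finset.mem_univ _, mul_lt_mul_of_pos_left ?_ (hpos u)⟩
  refine Finset.sum_lt_sum_of_subset (hsub u) (i := v) ?_ ?_ (hpos v) fun j _ _ => (hpos j).le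
  · rw [SimpleGraph.mem_neighborFinset]
    exact Or.inr (by simp [SimpleGraph.edge_adj, huv])
  · rwa [SimpleGraph.mem_neighborFinset]

/-- In a spectral extremal graph the exceptional vertex has `r` neighbours in each part. -/
theorem le_card_neighborFinset_inter {r : ℕ} (hr : 1 ≤ r)
    (hx : IsPerron G (graphSpectralRadius G) x) (hpos : ∀ i, 0 < x i)
    (h : IsBipartiteOff G w A B) (hnb : ¬G.IsBipartite)
    (hB : #(G.neighborFinset w ∩ B) ≤ r) (hA : r < #A)
    (hmax : ∀ G' : SimpleGraph V, ¬G'.IsBipartite → (bookGraph (r + 1)).Free G' →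
      graphSpectralRadius G' ≤ graphSpectralRadius G) :
    r ≤ #(G.neighborFinset w ∩ A) := by
  classical
  by_contra! hlt
  obtain ⟨i, hi, hin⟩ := Finset.exists_mem_notMem_of_card_lt_card (hlt.trans hA)
  have hwi : ¬G.Adj w i := fun hadj =>
    hin (Finset.mem_inter.2 ⟨(G.mem_neighborFinset w i).2 hadj, hi⟩)
  have hiw : w ≠ i := fun e => h.notMemA (e ▸ hi)
  refine absurd (hmax (G ⊔ SimpleGraph.edge w i) (fun hb => hnb (hb.mono_left le_sup_left)) ?_)
    (not_le.2 (graphSpectralRadius_lt_of_edge hx hpos hiw hwi))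
  have hadj : ∀ u v, (G ⊔ SimpleGraph.edge w i).Adj u v →
      G.Adj u v ∨ (u = w ∧ v = i) ∨ (u = i ∧ v = w) := by
    intro u v huv
    rw [SimpleGraph.sup_adj, SimpleGraph.edge_adj] at huv
    tauto
  have hoff : IsBipartiteOff (G ⊔ SimpleGraph.edge w i) w A B := by
    refine ⟨h.notMemA, h.notMemB, h.disj, h.cover, ?_, ?_⟩
    · intro u hu v hv huv
      rcases hadj u v huv with h1 | ⟨rfl, -⟩ | ⟨-, rfl⟩
      · exact h.indepA u hu v hv h1
      · exact h.notMemA hu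
      · exact h.notMemA hv
    · intro u hu v hv huv
      rcases hadj u v huv with h1 | ⟨rfl, -⟩ | ⟨-, rfl⟩
      · exact h.indepB u hu v hv h1
      · exact h.notMemB hu
      · exact h.notMemB hv
  have hiB : i ∉ B := Finset.disjoint_left.1 h.disj hi
  rw [free_bookGraph_iff]
  refine hoff.codegreeLE hr ?_ ?_
  · refine (Finset.card_le_card (t := insert i (G.neighborFinset w ∩ A)) fun j hj => ?_).trans
      ((Finset.card_insert_le _ _).trans hlt)
    rw [Finset.mem_inter, SimpleGraph.mem_neighborFinset] at hj
    rw [Finset.mem_insert, Finset.mem_inter, SimpleGraph.mem_neighborFinset]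
    have := hadj w j hj.1
    tauto
  · refine (Finset.card_le_card fun j hj => ?_).trans hB
    rw [Finset.mem_inter, SimpleGraph.mem_neighborFinset] at hj ⊢
    rcases hadj w j hj.1 with h1 | ⟨-, rfl⟩ | ⟨e, -⟩
    · exact ⟨h1, hj.2⟩
    · exact absurd hj.2 hiB
    · exact absurd e hiw

/-- The size of a spectral extremal graph. -/
theorem exists_card_edgeFinset_eq {r : ℕ} (hr : 1 ≤ r) : ∃ N : ℕ, ∀ {V : Type} [Fintype V]
    [DecidableEq V] (G : SimpleGraph V) [DecidableRel G.Adj], N ≤ Fintype.card V →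
    ¬G.IsBipartite → (bookGraph (r + 1)).Free G →
    (∀ G' : SimpleGraph V, ¬G'.IsBipartite → (bookGraph (r + 1)).Free G' →
      graphSpectralRadius G' ≤ graphSpectralRadius G) →
    #G.edgeFinset = (Fintype.card V - 1) / 2 * (Fintype.card V / 2) + 2 * r := by
  obtain ⟨C, N₁, h₁⟩ := exists_le_card_edgeFinset_add r
  -- An edge count of q - C gives n² ≤ 4e + 2n + 4C.
  obtain ⟨N₂, h₂⟩ := exists_isBipartiteOff r (4 * C)
  let K := 10 * (C + r + 1)
  refine ⟨N₁ + N₂ + (20 * (17 * K + 2) + 1024 * K ^ 2 + 1) + (1024 * r ^ 2 + 4),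
    fun {V} _ _ G _ hn hnb hfree hmax => ?_⟩
  obtain ⟨hn₁, hn₂, hn₃, hn₄⟩ : N₁ ≤ Fintype.card V ∧ N₂ ≤ Fintype.card V ∧
      20 * (17 * K + 2) + 1024 * K ^ 2 + 1 ≤ Fintype.card V ∧
      1024 * r ^ 2 + 4 ≤ Fintype.card V := by
    generalize 20 * (17 * K + 2) + 1024 * K ^ 2 + 1 = P at *
    generalize 1024 * r ^ 2 + 4 = Q at *
    omega
  have hG := (free_bookGraph_iff r).1 hfree
  have hne : Nonempty V := Fintype.card_pos_iff.1 (by omega)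
  obtain ⟨G₀, hnb₀, hfree₀, hρ₀, hq₀⟩ :=
    exists_le_graphSpectralRadius_sq (V := V) hr (by omega)
  have hle := hmax G₀ hnb₀ hfree₀
  have hρ : 0 ≤ graphSpectralRadius G := hρ₀.trans hle
  have hq : (((Fintype.card V - 1) / 2 * (Fintype.card V / 2) : ℕ) : ℝ) ≤
      graphSpectralRadius G ^ 2 := hq₀.trans (by gcongr)
  obtain ⟨x, hx⟩ := exists_isPerron G
  have hm := h₁ G hn₁ hG hx hρ hq
  have hn4 := sq_le_four_mul_half_mul_half (Fintype.card V)
  obtain ⟨w', A', B', h'⟩ := h₂ G hn₂ hG (by omega)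
  obtain ⟨w, A, B, h, hc⟩ := hx.exists_complete h' hG hnb hρ hq hm (K := K) rfl hn₃
  have hρpos : 0 < graphSpectralRadius G := by
    have h5 := card_le_four_mul hρ hq (by omega)
    have h6 : (4 : ℝ) ≤ Fintype.card V := by
      have : 4 ≤ Fintype.card V := by omega
      exact_mod_cast this
    linarith
  have hpos := hx.pos_of_complete hρpos h hc hnb
  -- For a neighbour b of w in B, all neighbours of w in A are common neighbours of w and b.
  have hside : ∀ {A B : Finset V}, IsBipartiteOff G w A B → (∀ i ∈ A, ∀ j ∈ B, G.Adj i j) →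
      #(G.neighborFinset w ∩ A) ≤ r := by
    intro A B h hc
    obtain ⟨b, hb⟩ := Finset.card_pos.1 (h.symm.one_le_card_inter hnb)
    rw [Finset.mem_inter, SimpleGraph.mem_neighborFinset] at hb
    refine (Finset.card_le_card fun j hj => ?_).trans (hG w b hb.1)
    simp only [Finset.mem_inter, SimpleGraph.mem_neighborFinset] at hj ⊢
    exact ⟨hj.1, (hc j hj.2 b hb.2).symm⟩
  have hc' : ∀ i ∈ B, ∀ j ∈ A, G.Adj i j := fun i hi j hj => (hc j hj i hi).symm
  have hs := hside h hc
  have ht := hside h.symm hc'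
  have hKr : 20 * C + 100 ≤ Fintype.card V ∧ 10 * r < Fintype.card V := by
    have : K = 10 * (C + r + 1) := rfl
    omega
  have ha := h.card_le_five_mul hm hKr.1
  have hb := h.symm.card_le_five_mul hm hKr.1
  have hs' := le_card_neighborFinset_inter hr hx hpos h hnb ht (by omega) hmax
  have ht' := le_card_neighborFinset_inter hr hx hpos h.symm hnb hs (by omega) hmax
  have hab := hx.mul_eq_half_mul_half h hρ hq (r := r) (by rw [h.degree_eq]; omega) hn₄
  have hedge := h.card_edgeFinset_add
  have hzero : ∑ i ∈ A, #(B \ G.neighborFinset i) = 0 := by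
    refine Finset.sum_eq_zero fun i hi => ?_
    rw [Finset.card_eq_zero, Finset.sdiff_eq_empty_iff_subset]
    exact fun j hj => (G.mem_neighborFinset i j).2 (hc i hi j hj)
  omega

end Extremal

theorem mainTheorem2 (r : ℕ) (hr : 1 ≤ r) :
    ∃ n₀ : ℕ, ∀ n : ℕ, n₀ ≤ n → Spex₃ n (bookGraph (r + 1)) ⊆ Ex₃ n (bookGraph (r + 1)) := by
  classical
  obtain ⟨N₁, h₁⟩ := exists_card_edgeFinset_le hr
  obtain ⟨N₂, h₂⟩ := exists_card_edgeFinset_eq hr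
  refine ⟨N₁ + N₂, fun n hn G hG => ⟨hG.1, fun G' _ hG' => ?_⟩⟩
  have h3 := h₁ G' (by rw [Fintype.card_fin]; omega) ((free_bookGraph_iff r).1 hG'.2) hG'.1
  have h4 := h₂ G (by rw [Fintype.card_fin]; omega) hG.1.1 hG.1.2
    (fun G'' hnb hfree => hG.2 G'' ⟨hnb, hfree⟩)
  rw [← h4] at h3
  convert h3
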